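/- Consider the square lattice $\mathbb{Z}^2$ with nearest-neighbour edges, and let $\Gamma$ be the set of all simple loops (cycles, unrooted and unoriented) in the dual lattice $\mathbb{Z}^2+(\tfrac12,\tfrac12)$. A vertex $v\in\mathbb{Z}^2$ is inside $\gamma\in\Gamma$ (or $\gamma$ contains $v$) if it lies in the bounded part of the plane enclosed by $\gamma$. Let $V_\gamma$ be the set of vertices that are inside $\gamma$ or on an edge whose dual edge belongs to $\gamma$, and put $S_\gamma=|V_\gamma|$. Two loops are congruent if one is obtained from the other by a composition of lattice translations, rotations by $90$ degrees and reflections; the class $[\gamma]$ is the type of $\gamma$, $n_{[\gamma]}$ is the number of loops of type $[\gamma]$ that contain the origin, and $S_{[\gamma]}=S_\gamma$. Let $f=(f_\gamma)_{\gamma\in\Gamma}$ be positive numbers that are constant on every type, and write $f_{[\gamma]}=f_\gamma$. Let the couplings $J_{xy}$ (one for every edge $xy$ of $\mathbb{Z}^2$) be i.i.d. real random variables and let the initial spins $\sigma_0(v)\in\{-1,1\}$, $v\in\mathbb{Z}^2$, be i.i.d., with arbitrary laws. Attach to every $\gamma\in\Gamma$ a Poisson clock of rate $f_\gamma$ and to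 every ring of it a fair coin; couplings, initial spins, clocks and coins are all independent, and $\mathbf{P}_{\mathcal J,\sigma_0,\omega}$ is their joint (product) law. For a configuration $\sigma\in\{-1,1\}^{\mathbb{Z}^2}$ put $$\mathcal{H}^\gamma_{\mathcal J}(\sigma)=-\sum_{xy:\ (xy)^*\in\gamma}J_{xy}\sigma_x\sigma_y .$$ A path $(\sigma_t)_{t\ge0}$ of configurations is an evolution of the loop dynamics for given couplings, initial configuration, ring times and coins if it starts at the initial configuration; the spin at $v$ is constant over any time interval in which no loop containing $v$ rings; and, whenever the clock of a loop $\gamma$ rings, say at time $t$, the configuration $\sigma_{t-}$ just before (the pointwise left limit) exists, and the spins at time $t$ of all vertices inside $\gamma$ are the negatives of those in $\sigma_{t-}$ if $\mathcal{H}^\gamma_{\mathcal J}(\sigma_{t-})>0$, or if $\mathcal{H}^\gamma_{\mathcal J}(\sigma_{t-})=0$ and the coin of this ring says so, and are those in $\sigma_{t-}$ otherwise. If $$\sum_{[\gamma]} n_{[\gamma]}\,f_{[\gamma]}\,S_{[\gamma]}<\infty ,$$ the sum being over all types of loops, then the loop dynamics is $\mathbf{P}_{\mathcal J,\sigma_0,\omega}$-almost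 surely well defined: there are random configurations $\sigma_t$, $t\ge0$, each a measurable function of the couplings, the initial configuration, the clocks and the coins, such that almost surely $(\sigma_t)_{t\ge0}$ is an evolution of the loop dynamics, and it is the only one. -/

import Mathlib

open MeasureTheory ProbabilityTheory
open scoped NNReal ENNReal Topology

noncomputable section

namespace LoopDynamics

/-! ### The square lattice and its dual -/

/-- The square lattice `ℤ²` with nearest-neighbour edges. The dual lattice is the translate
`ℤ² + (1/2, 1/2)`; the dual vertex `(a + 1/2, b + 1/2)` is denoted by its index `(a, b)`, and with
this indexing the dual graph is given by the same adjacency relation. -/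
def squareLattice : SimpleGraph (ℤ × ℤ) where
  Adj x y := |x.1 - y.1| + |x.2 - y.2| = 1
  symm := ⟨fun x y h => by rw [abs_sub_comm y.1, abs_sub_comm y.2]; exact h⟩
  loopless := ⟨fun x h => by simp at h⟩

/-- The position in the plane of a (primal) vertex. -/
def primalPoint (v : ℤ × ℤ) : ℝ × ℝ := ((v.1 : ℝ), (v.2 : ℝ))

/-- The position in the plane of the dual vertex with index `p`. -/
def dualPoint (p : ℤ × ℤ) : ℝ × ℝ := ((p.1 : ℝ) + 1 / 2, (p.2 : ℝ) + 1 / 2)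

/-- The closed segment in the plane representing a dual edge. -/
def dualSegment : Sym2 (ℤ × ℤ) → Set (ℝ × ℝ) :=
  Sym2.lift ⟨fun p q => segment ℝ (dualPoint p) (dualPoint q), fun _ _ => segment_symm ℝ _ _⟩

/-- The primal edge whose dual is a given dual edge. For the horizontal dual edge with indices
`(a, b)`, `(a + 1, b)` it is the primal edge from `(a + 1, b)` to `(a + 1, b + 1)`, and for the
vertical dual edge with indices `(a, b)`, `(a, b + 1)` it is the primal edge from `(a, b + 1)` to
`(a + 1, b + 1)`. -/
def primalEdge : Sym2 (ℤ × ℤ) → Sym2 (ℤ × ℤ) :=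
  Sym2.lift ⟨fun p q => s(p ⊔ q, p ⊓ q + (1, 1)), fun p q => by simp only [sup_comm p q, inf_comm p q]⟩

theorem primalEdge_mem {d : Sym2 (ℤ × ℤ)} (hd : d ∈ squareLattice.edgeSet) :
    primalEdge d ∈ squareLattice.edgeSet := by
  induction d with
  | h p q =>
    obtain ⟨a, b⟩ := p
    obtain ⟨c, e⟩ := q
    simp only [SimpleGraph.mem_edgeSet, squareLattice, primalEdge, Sym2.lift_mk] at hd ⊢
    simp only [Prod.mk_sup_mk, Prod.mk_inf_mk, Prod.mk_add_mk]
    rcases abs_cases (a - c) with h1 | h1 <;> rcases abs_cases (b - e) with h2 | h2 <;>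
      rcases le_total a c with h3 | h3 <;> rcases le_total b e with h4 | h4 <;>
      simp only [sup_of_le_left, sup_of_le_right, inf_of_le_left, inf_of_le_right, h3, h4] <;>
      grind

/-! ### Loops -/

/-- A simple loop in the dual lattice, unrooted and unoriented: the finite edge set of a cycle. -/
structure Loop where
  edges : Finset (Sym2 (ℤ × ℤ))
  isLoop : ∃ (p : ℤ × ℤ) (w : squareLattice.Walk p p), w.IsCycle ∧ w.edges.toFinset = edges

theorem Loop.mem_edgeSet (γ : Loop) {d : Sym2 (ℤ × ℤ)} (hd : d ∈ γ.edges) :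
    d ∈ squareLattice.edgeSet := by
  obtain ⟨p, w, -, hw⟩ := γ.isLoop
  rw [← hw, List.mem_toFinset] at hd
  exact w.edges_subset_edgeSet hd

/-- The closed curve in the plane traced by a loop. -/
def Loop.trace (γ : Loop) : Set (ℝ × ℝ) := ⋃ d ∈ γ.edges, dualSegment d

/-- The vertex `v` is inside `γ`: it lies in a bounded component of the complement of `γ` in the
plane. -/
def Loop.Contains (γ : Loop) (v : ℤ × ℤ) : Prop :=
  Bornology.IsBounded (connectedComponentIn γ.traceᶜ (primalPoint v))

/-- `V_γ`: the vertices inside `γ` or on a primal edge whose dual is in `γ`. -/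
def Loop.vertices (γ : Loop) : Set (ℤ × ℤ) :=
  {v | γ.Contains v ∨ ∃ d ∈ γ.edges, v ∈ primalEdge d}

/-- `S_γ = |V_γ|`. -/
def Loop.size (γ : Loop) : ℕ∞ := γ.vertices.encard

/-- The group generated by the translations, the rotation by 90 degrees and a reflection,
acting on (indices of) dual vertices. -/
def latticeSymmetries : Subgroup (Equiv.Perm (ℤ × ℤ)) :=
  Subgroup.closure
    (Set.range (fun a : ℤ × ℤ => Equiv.addRight a) ∪
      {{ toFun := fun p => (-p.2, p.1)
         invFun := fun p => (p.2, -p.1)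
         left_inv := fun p => by simp
         right_inv := fun p => by simp },
       { toFun := fun p => (-p.1, p.2)
         invFun := fun p => (-p.1, p.2)
         left_inv := fun p => by simp
         right_inv := fun p => by simp }})

/-- Congruence of loops. -/
instance congruence : Setoid Loop where
  r γ γ' := ∃ g ∈ latticeSymmetries, γ'.edges = γ.edges.image (Sym2.map g)
  iseqv := by
    refine ⟨fun γ => ⟨1, one_mem _, ?_⟩, ?_, ?_⟩
    · simp [Equiv.Perm.coe_one]
    · rintro γ γ' ⟨g, hg, h⟩
      refine ⟨g⁻¹, inv_mem hg, ?_⟩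
      rw [h, Finset.image_image, Sym2.map_comp.symm]
      have : (⇑g⁻¹ ∘ ⇑g) = id := by ext x <;> simp
      rw [this, Sym2.map_id, Finset.image_id]
    · rintro γ γ' γ'' ⟨g, hg, h⟩ ⟨g', hg', h'⟩
      refine ⟨g' * g, mul_mem hg' hg, ?_⟩
      rw [h', h, Finset.image_image, Sym2.map_comp.symm]
      rfl

/-- The types of loops, i.e. their congruence classes. -/
abbrev LoopType : Type := Quotient congruence

/-- `n_c`: the number of loops of type `c` that contain the origin. -/
def LoopType.count (c : LoopType) : ℕ∞ := {γ : Loop | ⟦γ⟧ = c ∧ γ.Contains (0, 0)}.encard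

/-- Loop frequencies are proper if they are constant on every congruence class. -/
def Proper (f : Loop → ℝ) : Prop := ∀ γ γ' : Loop, γ ≈ γ' → f γ = f γ'

/-- `∑_c n_c f_c S_c`, summed over all loop types, in `[0, ∞]`. The values of `f` and of the size
on a type are read off at a representative. -/
def totalWeight (f : Loop → ℝ) : ℝ≥0∞ :=
  ∑' c : LoopType, (c.count : ℝ≥0∞) * ENNReal.ofReal (f c.out) * (c.out.size : ℝ≥0∞)

/-! ### The random input: couplings, initial spins, clocks and coins -/

/-- Spin configurations; the spins are `1` and `-1`, the elements of `ℤˣ`. -/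
abbrev Config : Type := ℤ × ℤ → ℤˣ

/-- Couplings `J`, indexed by the edges of the lattice. -/
abbrev Coupling : Type := squareLattice.edgeSet → ℝ

/-- The gaps between successive rings and the coins of all loops. -/
abbrev Clocks : Type := (Loop → ℕ → ℝ) × (Loop → ℕ → Bool)

/-- Couplings, initial configuration, and clocks with coins. -/
abbrev Sample : Type := Coupling × Config × Clocks

/-- Independent Poisson clocks with rate `f γ` for every loop `γ` (the gaps between rings are
independent exponential variables of parameter `f γ`) and, independently, fair coins. -/
def clockLaw (f : Loop → ℝ) : Measure Clocks :=
  (Measure.infinitePi fun γ : Loop => Measure.infinitePi fun _ : ℕ => expMeasure (f γ)).prod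
    (Measure.infinitePi fun _ : Loop => Measure.infinitePi fun _ : ℕ =>
      (PMF.uniformOfFintype Bool).toMeasure)

/-- The joint law: i.i.d. couplings of law `νJ`, i.i.d. initial spins of law `νS`, and the clocks
and coins, all independent. -/
def jointLaw (νJ : Measure ℝ) (νS : Measure ℤˣ) (f : Loop → ℝ) : Measure Sample :=
  (Measure.infinitePi fun _ : squareLattice.edgeSet => νJ).prod
    ((Measure.infinitePi fun _ : ℤ × ℤ => νS).prod (clockLaw f))

/-- The time of the ring number `k` (counted from `0`) of the clock of `γ`. -/
def ringTime (ω : Clocks) (γ : Loop) (k : ℕ) : ℝ := ∑ i ∈ Finset.range (k + 1), ω.1 γ i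

/-! ### The dynamics -/

/-- The product of the two spins on an edge. -/
def spinProduct (σ : Config) : Sym2 (ℤ × ℤ) → ℝ :=
  Sym2.lift ⟨fun x y => ((σ x * σ y : ℤˣ) : ℤ), fun x y => by simp only [mul_comm (σ x)]⟩

/-- `H^γ_J(σ) = - ∑ J_{xy} σ_x σ_y`, over the edges `xy` whose dual is in `γ`. -/
def loopEnergy (J : Coupling) (γ : Loop) (σ : Config) : ℝ :=
  -∑ d ∈ γ.edges.attach,
    J ⟨primalEdge d.1, primalEdge_mem (γ.mem_edgeSet d.2)⟩ * spinProduct σ (primalEdge d.1)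

/-- At a ring of `γ`, with `σ` the configuration just before, the spins inside `γ` are flipped:
the energy is positive, or it is zero and the coin says so. -/
def Flips (J : Coupling) (γ : Loop) (σ : Config) (coin : Bool) : Prop :=
  0 < loopEnergy J γ σ ∨ (loopEnergy J γ σ = 0 ∧ coin = true)

/-- The path `σ` evolves according to the loop dynamics driven by the couplings, initial
configuration, clocks and coins in `ϖ`: it starts at the initial configuration, a spin is constant
over any time interval in which no loop containing it rings, and at each ring of a loop `γ` the
configuration `ξ = σ_{t-}` just before the ring exists and the spins inside `γ` are updated by the
rule of the dynamics applied to `ξ`. -/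
structure IsEvolution (ϖ : Sample) (σ : ℝ≥0 → Config) : Prop where
  initial : σ 0 = ϖ.2.1
  constant : ∀ (v : ℤ × ℤ) (s t : ℝ≥0), s ≤ t →
    (∀ (γ : Loop) (k : ℕ), γ.Contains v → ringTime ϖ.2.2 γ k ∉ Set.Ioc (s : ℝ) (t : ℝ)) →
    σ t v = σ s v
  ring : ∀ (γ : Loop) (k : ℕ) (t : ℝ≥0), (t : ℝ) = ringTime ϖ.2.2 γ k →
    ∃ ξ : Config, (∀ v, ∀ᶠ s in 𝓝[<] t, σ s v = ξ v) ∧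
      (Flips ϖ.1 γ ξ (ϖ.2.2.2 γ k) → ∀ v, γ.Contains v → σ t v = -ξ v) ∧
      (¬ Flips ϖ.1 γ ξ (ϖ.2.2.2 γ k) → ∀ v, γ.Contains v → σ t v = ξ v)

end LoopDynamics

end

noncomputable section

namespace LoopDynamics

/-! Whether a ring of `γ` flips depends only on the spins at the ends of the edges crossed by `γ`,
hence only on earlier rings of loops that contain such an end. Following this dependence back in
time gives chains of linked rings. The dynamics is a recursion along the relation `Influences`, and
it is well posed once this relation is well founded and each vertex sees finitely many rings in
bounded time.

Both follow from a first moment bound. A chain ending at time `t` gets weight `exp (-θ t)`, which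
factors over the time differences along the chain. Given the rest of the chain, summing over the
rings of its latest loop `γ` costs at most `f γ / θ` (`tsum_lintegral_expKernel_le`, from the
renewal bound `sum_lintegral_gap_le`). Choosing the vertex that links `γ` to the next loop costs
`S_γ`. By translation invariance the sum of `f γ * S_γ` over the loops containing a given vertex is
at most `totalWeight f`, so chains of length `n + 1` weigh at most `(totalWeight f / θ) ^ (n + 1)`
(`tsum_chainMass_le`). For large `θ` this is summable, and almost surely only finitely many chains
end at a given vertex before a given time (`ae_finite_chains`).

For such ring times, a solution of the flip recursion yields an evolution (`isEvolution_configOf`),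
and every evolution arises from that solution (`IsEvolution.eq_configOf`). The solution is built as
an eventually constant limit of measurable approximations (`eventually_approxFlip_iff`), which makes
the dynamics measurable. -/

/-! ### Invariance of loops under the lattice symmetries -/

/-- A description of the dual edge by distances alone (`ℝ × ℝ` carries the sup metric), so that any
plane isometry preserving both lattices respects it. -/
theorem mem_primalEdge_iff {p q : ℤ × ℤ} (h : squareLattice.Adj p q) (v : ℤ × ℤ) :
    v ∈ primalEdge s(p, q) ↔
      dist (primalPoint v) (dualPoint p) = 1 / 2 ∧ dist (primalPoint v) (dualPoint q) = 1 / 2 := by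
  have key : ∀ p : ℤ × ℤ, dist (primalPoint v) (dualPoint p) = 1 / 2 ↔
      (v.1 = p.1 ∨ v.1 = p.1 + 1) ∧ (v.2 = p.2 ∨ v.2 = p.2 + 1) := by
    intro p
    have h1 : ∀ a b : ℤ, 1 / 2 ≤ |(a : ℝ) - (b + 1 / 2)| := by
      intro a b
      rcases le_or_gt a b with hab | hab
      · have : (a : ℝ) ≤ b := by exact_mod_cast hab
        rw [abs_of_neg (by linarith)]; linarith
      · have : (b : ℝ) + 1 ≤ a := by exact_mod_cast hab
        rw [abs_of_nonneg (by linarith)]; linarith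
    have h2 : ∀ a b : ℤ, |(a : ℝ) - (b + 1 / 2)| ≤ 1 / 2 ↔ (a = b ∨ a = b + 1) := by
      intro a b
      rw [abs_le]
      constructor
      · rintro ⟨h3, h4⟩
        have h5 : (b : ℝ) ≤ a := by linarith
        have h6 : (a : ℝ) ≤ b + 1 := by linarith
        have h5' : b ≤ a := by exact_mod_cast h5
        have h6' : a ≤ b + 1 := by exact_mod_cast h6
        omega
      · rintro (rfl | rfl)
        · constructor <;> linarith
        · push_cast; constructor <;> linarith
    rw [← h2, ← h2, Prod.dist_eq, Real.dist_eq, Real.dist_eq]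
    simp only [primalPoint, dualPoint]
    rw [← max_le_iff]
    refine ⟨fun h => h.le, fun h => le_antisymm h ((h1 v.1 p.1).trans (le_max_left _ _))⟩
  rw [key, key]
  obtain ⟨a, b⟩ := p
  obtain ⟨c, e⟩ := q
  obtain ⟨x, y⟩ := v
  simp only [squareLattice, primalEdge, Sym2.lift_mk] at h ⊢
  simp only [Prod.mk_sup_mk, Prod.mk_inf_mk, Prod.mk_add_mk, Sym2.mem_iff, Prod.mk.injEq]
  rcases abs_cases (a - c) with h1 | h1 <;> rcases abs_cases (b - e) with h2 | h2 <;>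
      rcases le_total a c with h3 | h3 <;> rcases le_total b e with h4 | h4 <;>
      simp only [sup_of_le_left, sup_of_le_right, inf_of_le_left, inf_of_le_right, h3, h4] <;>
      omega

/-- The permutation `g` of the dual lattice is induced by the isometry `P` of the plane, which also
induces the permutation `h` of the primal lattice. -/
structure Realizes (g : Equiv.Perm (ℤ × ℤ)) (P : (ℝ × ℝ) ≃ᵃⁱ[ℝ] (ℝ × ℝ))
    (h : Equiv.Perm (ℤ × ℤ)) : Prop where
  adj : ∀ p q, squareLattice.Adj (g p) (g q) ↔ squareLattice.Adj p q
  dual : ∀ p, P (dualPoint p) = dualPoint (g p)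
  primal : ∀ v, P (primalPoint v) = primalPoint (h v)

theorem realizes_translation (a : ℤ × ℤ) :
    Realizes (Equiv.addRight a) (AffineIsometryEquiv.constVAdd ℝ (ℝ × ℝ) (primalPoint a))
      (Equiv.addRight a) where
  adj p q := by simp [squareLattice]
  dual p := by
    ext <;> simp [primalPoint, dualPoint] <;> ring
  primal v := by
    ext <;> simp [primalPoint] <;> ring

theorem Realizes.mul {g g' h h' : Equiv.Perm (ℤ × ℤ)} {P P' : (ℝ × ℝ) ≃ᵃⁱ[ℝ] (ℝ × ℝ)}
    (H : Realizes g P h) (H' : Realizes g' P' h') : Realizes (g * g') (P * P') (h * h') where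
  adj p q := by simp [H.adj, H'.adj]
  dual p := by simp [H.dual, H'.dual]
  primal v := by simp [H.primal, H'.primal]

theorem Realizes.inv {g h : Equiv.Perm (ℤ × ℤ)} {P : (ℝ × ℝ) ≃ᵃⁱ[ℝ] (ℝ × ℝ)}
    (H : Realizes g P h) : Realizes g⁻¹ P⁻¹ h⁻¹ where
  adj p q := by
    rw [← H.adj]
    exact iff_of_eq (congrArg₂ _ (g.apply_symm_apply p) (g.apply_symm_apply q))
  dual p := by
    refine P.injective ((P.apply_symm_apply _).trans ?_)
    rw [H.dual]
    exact congrArg _ (g.apply_symm_apply p).symm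
  primal v := by
    refine P.injective ((P.apply_symm_apply _).trans ?_)
    rw [H.primal]
    exact congrArg _ (h.apply_symm_apply v).symm

/-- The rotation by 90 degrees of the plane. -/
def planeRotation : (ℝ × ℝ) ≃ₗᵢ[ℝ] (ℝ × ℝ) where
  toFun x := (-x.2, x.1)
  invFun x := (x.2, -x.1)
  map_add' x y := by ext <;> simp; ring
  map_smul' c x := by ext <;> simp
  left_inv x := by simp
  right_inv x := by simp
  norm_map' x := by simp [Prod.norm_def, max_comm]

/-- The reflection of the plane in the vertical axis. -/
def planeReflection : (ℝ × ℝ) ≃ₗᵢ[ℝ] (ℝ × ℝ) where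
  toFun x := (-x.1, x.2)
  invFun x := (-x.1, x.2)
  map_add' x y := by ext <;> simp; ring
  map_smul' c x := by ext <;> simp
  left_inv x := by simp
  right_inv x := by simp
  norm_map' x := by simp [Prod.norm_def]

theorem exists_realizes {g : Equiv.Perm (ℤ × ℤ)} (hg : g ∈ latticeSymmetries) :
    ∃ P h, Realizes g P h := by
  induction hg using Subgroup.closure_induction with
  | mem g hg =>
    rcases hg with ⟨a, rfl⟩ | rfl | rfl
    · exact ⟨_, _, realizes_translation a⟩
    -- The symmetries act on indices, and the dual point of index `p` is `p + (1/2, 1/2)`. The shift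
    -- by `(1, 0)` corrects for this offset; the same shift serves the reflection.
    · refine ⟨AffineIsometryEquiv.constVAdd ℝ (ℝ × ℝ) (1, 0) *
        planeRotation.toAffineIsometryEquiv,
        { toFun := fun p => (1 - p.2, p.1)
          invFun := fun p => (p.2, 1 - p.1)
          left_inv := fun p => by simp
          right_inv := fun p => by simp }, ?_, ?_, ?_⟩
      · intro p q
        simp only [squareLattice, Equiv.coe_fn_mk]
        rw [add_comm, show -p.2 - -q.2 = -(p.2 - q.2) by ring, abs_neg]
      · intro p
        ext <;> simp [planeRotation, dualPoint]
        ring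
      · intro v
        ext <;> simp [planeRotation, primalPoint]
        ring
    · refine ⟨AffineIsometryEquiv.constVAdd ℝ (ℝ × ℝ) (1, 0) *
        planeReflection.toAffineIsometryEquiv,
        { toFun := fun p => (1 - p.1, p.2)
          invFun := fun p => (1 - p.1, p.2)
          left_inv := fun p => by simp
          right_inv := fun p => by simp }, ?_, ?_, ?_⟩
      · intro p q
        simp only [squareLattice, Equiv.coe_fn_mk]
        rw [show -p.1 - -q.1 = -(p.1 - q.1) by ring, abs_neg]
      · intro p
        ext <;> simp [planeReflection, dualPoint]
        ring
      · intro v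
        ext <;> simp [planeReflection, primalPoint]
        ring
  | one => exact ⟨1, 1, fun _ _ => Iff.rfl, fun _ => rfl, fun _ => rfl⟩
  | mul x y _ _ hx hy =>
    obtain ⟨P, h, H⟩ := hx
    obtain ⟨P', h', H'⟩ := hy
    exact ⟨_, _, H.mul H'⟩
  | inv x _ hx =>
    obtain ⟨P, h, H⟩ := hx
    exact ⟨_, _, H.inv⟩

section Equivariance

variable {γ γ' : Loop} {g h : Equiv.Perm (ℤ × ℤ)} {P : (ℝ × ℝ) ≃ᵃⁱ[ℝ] (ℝ × ℝ)}

theorem Realizes.trace_eq (H : Realizes g P h) (hγ : γ'.edges = γ.edges.image (Sym2.map g)) :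
    γ'.trace = P '' γ.trace := by
  have hd : ∀ d, dualSegment (Sym2.map g d) = P '' dualSegment d := by
    intro d
    induction d with
    | h p q =>
      simp only [Sym2.map_mk, dualSegment, Sym2.lift_mk, ← H.dual]
      exact (image_segment ℝ P.toAffineEquiv.toAffineMap _ _).symm
  rw [Loop.trace, Loop.trace, hγ, Set.image_iUnion₂, Finset.set_biUnion_finset_image]
  simp only [hd]

theorem Realizes.contains_iff (H : Realizes g P h) (hγ : γ'.edges = γ.edges.image (Sym2.map g))
    (v : ℤ × ℤ) : γ'.Contains (h v) ↔ γ.Contains v := by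
  have himg : connectedComponentIn γ'.traceᶜ (primalPoint (h v)) =
      P '' connectedComponentIn γ.traceᶜ (primalPoint v) := by
    rw [← H.primal, H.trace_eq hγ, ← Set.image_compl_eq P.bijective]
    -- If the point lay on the trace, both components would be empty by convention, so it need not
    -- be shown that primal points avoid the trace.
    by_cases hv : primalPoint v ∈ γ.traceᶜ
    · exact (P.toHomeomorph.image_connectedComponentIn hv).symm
    · rw [connectedComponentIn_eq_empty hv, Set.image_empty]
      refine connectedComponentIn_eq_empty ?_
      rwa [P.injective.mem_set_image]
  rw [Loop.Contains, Loop.Contains, himg]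
  constructor
  · intro hb
    have := P.symm.isometry.lipschitz.isBounded_image hb
    rwa [Set.image_image, Set.image_congr fun x _ => P.symm_apply_apply x, Set.image_id'] at this
  · exact P.isometry.lipschitz.isBounded_image

theorem Realizes.mem_vertices_iff (H : Realizes g P h)
    (hγ : γ'.edges = γ.edges.image (Sym2.map g)) (v : ℤ × ℤ) :
    h v ∈ γ'.vertices ↔ v ∈ γ.vertices := by
  simp only [Loop.vertices, Set.mem_ofPred_eq, H.contains_iff hγ, hγ, Finset.exists_mem_image]
  refine or_congr_right (exists_congr fun d => and_congr_right fun hd => ?_)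
  have hd' := γ.mem_edgeSet hd
  induction d with
  | h p q =>
    rw [SimpleGraph.mem_edgeSet] at hd'
    rw [Sym2.map_mk, mem_primalEdge_iff hd', mem_primalEdge_iff ((H.adj p q).2 hd'),
      ← H.dual, ← H.dual, ← H.primal, P.dist_map, P.dist_map]

theorem Realizes.size_eq (H : Realizes g P h) (hγ : γ'.edges = γ.edges.image (Sym2.map g)) :
    γ'.size = γ.size := by
  have : γ'.vertices = h '' γ.vertices := by
    ext v
    obtain ⟨w, rfl⟩ := h.surjective v
    rw [h.injective.mem_set_image, H.mem_vertices_iff hγ]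
  rw [Loop.size, Loop.size, this, h.injective.encard_image]

end Equivariance

theorem size_eq_of_equiv {γ γ' : Loop} (hγ : γ ≈ γ') : γ.size = γ'.size := by
  obtain ⟨g, hg, hg'⟩ := hγ
  obtain ⟨P, h, H⟩ := exists_realizes hg
  exact (H.size_eq hg').symm

/-! ### Sums over the loops that contain a vertex -/

@[ext]
theorem Loop.ext {γ γ' : Loop} (h : γ.edges = γ'.edges) : γ = γ' := by
  cases γ; cases γ'; cases h; rfl

/-- The translate of a loop. -/
def Loop.translate (a : ℤ × ℤ) (γ : Loop) : Loop where
  edges := γ.edges.image (Sym2.map (Equiv.addRight a))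
  isLoop := by
    obtain ⟨p, w, hw, hw'⟩ := γ.isLoop
    let φ : squareLattice →g squareLattice :=
      ⟨Equiv.addRight a, fun {p q} h => ((realizes_translation a).adj p q).2 h⟩
    refine ⟨φ p, w.map φ, hw.map (Equiv.addRight a).injective, ?_⟩
    rw [SimpleGraph.Walk.edges_map, ← hw']
    ext; simp [φ]

theorem Loop.translate_injective (a : ℤ × ℤ) : Function.Injective (Loop.translate a) := by
  intro γ γ' h
  have h' : γ.edges.image (Sym2.map (Equiv.addRight a)) =
    γ'.edges.image (Sym2.map (Equiv.addRight a)) := congrArg Loop.edges h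
  exact Loop.ext (Finset.image_injective (Sym2.map.injective (Equiv.injective _)) h')

theorem Loop.equiv_translate (a : ℤ × ℤ) (γ : Loop) : γ ≈ γ.translate a :=
  ⟨Equiv.addRight a, Subgroup.subset_closure (Or.inl ⟨a, rfl⟩), rfl⟩

theorem Loop.contains_translate (a : ℤ × ℤ) (γ : Loop) (v : ℤ × ℤ) :
    (γ.translate a).Contains (v + a) ↔ γ.Contains v :=
  (realizes_translation a).contains_iff rfl v

/-- The summand is constant on types, and the loops around the origin of type `c` number `n_c`;
grouping by type gives the sum. -/
theorem tsum_contains_origin {f : Loop → ℝ} (hf : Proper f) :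
    ∑' γ : {γ : Loop // γ.Contains (0, 0)}, ENNReal.ofReal (f γ) * (γ.1.size : ℝ≥0∞) =
      totalWeight f := by
  let F : Loop → ℝ≥0∞ := fun γ => ENNReal.ofReal (f γ) * (γ.size : ℝ≥0∞)
  have hF : ∀ γ γ' : Loop, γ ≈ γ' → F γ = F γ' := fun γ γ' h => by
    simp only [F, hf γ γ' h, size_eq_of_equiv h]
  rw [← (Equiv.sigmaFiberEquiv
    (fun γ : {γ : Loop // γ.Contains (0, 0)} => (⟦γ.1⟧ : LoopType))).tsum_eq, ENNReal.tsum_sigma']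
  refine tsum_congr fun c => ?_
  have h1 : ∀ x : {γ : {γ : Loop // γ.Contains (0, 0)} // (⟦γ.1⟧ : LoopType) = c},
      F x.1.1 = F c.out := by
    rintro ⟨x, hx⟩
    exact hF _ _ (Quotient.exact (hx.trans c.out_eq.symm))
  calc _ = ∑' x : {γ : {γ : Loop // γ.Contains (0, 0)} // (⟦γ.1⟧ : LoopType) = c}, F c.out :=
        tsum_congr h1
    _ = ENat.card {γ : {γ : Loop // γ.Contains (0, 0)} // (⟦γ.1⟧ : LoopType) = c} * F c.out :=
        ENNReal.tsum_const _
    _ = _ := by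
      rw [mul_assoc]
      congr 2
      refine ENat.card_congr ((Equiv.subtypeSubtypeEquivSubtypeInter _
        (fun γ : Loop => (⟦γ⟧ : LoopType) = c)).trans (Equiv.subtypeEquivRight fun γ => ?_))
      exact and_comm

/-- Translation by `-v` injects the loops around `v` into those around the origin and preserves the
summand. -/
theorem tsum_contains_le {f : Loop → ℝ} (hf : Proper f) (v : ℤ × ℤ) :
    ∑' γ : {γ : Loop // γ.Contains v}, ENNReal.ofReal (f γ) * (γ.1.size : ℝ≥0∞) ≤
      totalWeight f := by
  rw [← tsum_contains_origin hf]
  have hv : ∀ γ : {γ : Loop // γ.Contains v}, (γ.1.translate (-v)).Contains (0, 0) := fun γ => by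
    have := (Loop.contains_translate (-v) γ.1 v).2 γ.2
    rwa [add_neg_cancel] at this
  let e : {γ : Loop // γ.Contains v} → {γ : Loop // γ.Contains (0, 0)} :=
    fun γ => ⟨γ.1.translate (-v), hv γ⟩
  have he : Function.Injective e := fun γ γ' h =>
    Subtype.ext (Loop.translate_injective _ (congrArg Subtype.val h))
  refine le_trans (le_of_eq (tsum_congr fun γ => ?_)) (ENNReal.tsum_comp_le_tsum_of_injective he
    (fun γ => ENNReal.ofReal (f γ) * (γ.1.size : ℝ≥0∞)))
  have := γ.1.equiv_translate (-v)
  simp only [e]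
  rw [hf _ _ this, size_eq_of_equiv this]

instance : Countable Loop :=
  Function.Injective.countable (f := Loop.edges) fun _ _ h => Loop.ext h

/-! ### Resampling one coordinate of a product measure -/

/-- It suffices to compare measures of finite boxes; the preimage of a box is a rectangle whose
first factor is the side at `i`. -/
theorem infinitePi_map_update {ι : Type*} [DecidableEq ι] {X : ι → Type*}
    [∀ i, MeasurableSpace (X i)] (μ : ∀ i, Measure (X i)) [∀ i, IsProbabilityMeasure (μ i)]
    (i : ι) :
    ((μ i).prod (Measure.infinitePi μ)).map (fun p => Function.update p.2 i p.1) =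
      Measure.infinitePi μ := by
  have hmeas : Measurable (fun p : X i × (∀ j, X j) => Function.update p.2 i p.1) := by
    refine measurable_pi_lambda _ fun j => ?_
    by_cases hj : j = i
    · subst hj; simpa using measurable_fst
    · simp only [Function.update_of_ne hj]; fun_prop
  refine Measure.eq_infinitePi _ fun s t ht => ?_
  rw [Measure.map_apply hmeas (MeasurableSet.pi s.countable_toSet fun j _ => ht j)]
  have hpre : (fun p : X i × (∀ j, X j) => Function.update p.2 i p.1) ⁻¹' (Set.pi (s : Set ι) t) =
      (if i ∈ s then t i else Set.univ) ×ˢ (Set.pi ((s.erase i : Finset ι) : Set ι) t) := by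
    ext ⟨x, w⟩
    simp only [Set.mem_preimage, Set.mem_pi, Finset.mem_coe, Set.mem_prod, Finset.mem_erase]
    constructor
    · intro h
      refine ⟨?_, fun j hj => ?_⟩
      · split_ifs with hi
        · simpa using h i hi
        · trivial
      · simpa [Function.update_of_ne hj.1] using h j hj.2
    · rintro ⟨h1, h2⟩ j hj
      by_cases hji : j = i
      · subst hji; simpa [hj] using h1
      · simpa [Function.update_of_ne hji] using h2 j ⟨hji, hj⟩
  rw [hpre, Measure.prod_prod, Measure.infinitePi_pi μ (fun j _ => ht j)]
  split_ifs with hi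
  · rw [Finset.mul_prod_erase s (fun j => μ j (t j)) hi]
  · rw [measure_univ, one_mul, Finset.erase_eq_of_notMem hi]

theorem measurable_update_pair {ι : Type*} [DecidableEq ι] {X : ι → Type*}
    [∀ i, MeasurableSpace (X i)] (i : ι) :
    Measurable (fun p : (∀ j, X j) × X i => Function.update p.1 i p.2) := by
  refine measurable_pi_lambda _ fun j => ?_
  by_cases hj : j = i
  · subst hj; simpa using measurable_snd
  · simp only [Function.update_of_ne hj]; fun_prop

theorem lintegral_infinitePi_update {ι : Type*} [DecidableEq ι] {X : ι → Type*}
    [∀ i, MeasurableSpace (X i)] (μ : ∀ i, Measure (X i)) [∀ i, IsProbabilityMeasure (μ i)]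
    (i : ι) {H : (∀ j, X j) → ℝ≥0∞} (hH : Measurable H) :
    ∫⁻ w, H w ∂(Measure.infinitePi μ) =
      ∫⁻ w, ∫⁻ x, H (Function.update w i x) ∂(μ i) ∂(Measure.infinitePi μ) := by
  have hmeas : Measurable (fun p : X i × (∀ j, X j) => Function.update p.2 i p.1) :=
    (measurable_update_pair i).comp measurable_swap
  conv_lhs => rw [← infinitePi_map_update μ i, lintegral_map hH hmeas]
  exact lintegral_prod_symm' _ (hH.comp hmeas)

/-! ### The law of the gaps -/

/-- The gaps between successive rings of all loops. -/
abbrev Gaps : Type := Loop → ℕ → ℝ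

/-- The law of the gaps. -/
def gapLaw (f : Loop → ℝ) : Measure Gaps :=
  Measure.infinitePi fun γ : Loop => Measure.infinitePi fun _ : ℕ => expMeasure (f γ)

/-- The time of a ring as a function of the gaps. -/
def gapTime (g : Gaps) (a : Loop × ℕ) : ℝ := ∑ i ∈ Finset.range (a.2 + 1), g a.1 i

open Classical in
/-- Replace one gap. -/
def setGap (g : Gaps) (γ : Loop) (m : ℕ) (x : ℝ) : Gaps :=
  Function.update g γ (Function.update (g γ) m x)

@[simp]
theorem setGap_same (g : Gaps) (γ : Loop) (m : ℕ) (x : ℝ) : setGap g γ m x γ m = x := by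
  simp [setGap]

theorem setGap_of_ne_loop (g : Gaps) {γ γ' : Loop} (m : ℕ) (x : ℝ) (h : γ' ≠ γ) :
    setGap g γ m x γ' = g γ' := by
  simp [setGap, h]

theorem setGap_of_ne_index (g : Gaps) (γ : Loop) {m i : ℕ} (x : ℝ) (h : i ≠ m) :
    setGap g γ m x γ i = g γ i := by
  simp [setGap, h]

@[fun_prop]
theorem measurable_gapTime (a : Loop × ℕ) : Measurable fun g : Gaps => gapTime g a := by
  unfold gapTime; fun_prop

theorem measurable_setGap (γ : Loop) (m : ℕ) :
    Measurable fun p : Gaps × ℝ => setGap p.1 γ m p.2 := by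
  classical
  have h1 : Measurable fun p : Gaps × ℝ => Function.update (p.1 γ) m p.2 := by
    have h3 : Measurable fun p : Gaps × ℝ => (p.1 γ, p.2) := by fun_prop
    have h4 := (measurable_update_pair (X := fun _ : ℕ => ℝ) m).comp h3
    exact h4
  have h2 := (measurable_update_pair (X := fun _ : Loop => ℕ → ℝ) γ).comp
      (measurable_fst.prodMk h1)
  exact h2

section Law

variable {f : Loop → ℝ} (hf : ∀ γ, 0 < f γ)
include hf

theorem isProbabilityMeasure_gapLaw : IsProbabilityMeasure (gapLaw f) := by
  have := fun γ => isProbabilityMeasure_expMeasure (hf γ)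
  unfold gapLaw; infer_instance

/-- The form in which independence of the gaps is used: one gap may be integrated out with all
others fixed. -/
theorem lintegral_setGap (γ : Loop) (m : ℕ) {H : Gaps → ℝ≥0∞} (hH : Measurable H) :
    ∫⁻ g, H g ∂(gapLaw f) = ∫⁻ g, ∫⁻ x, H (setGap g γ m x) ∂(expMeasure (f γ)) ∂(gapLaw f) := by
  classical
  have := fun γ => isProbabilityMeasure_expMeasure (hf γ)
  have hH' : Measurable fun p : Gaps × ℝ => H (setGap p.1 γ m p.2) :=
    hH.comp (measurable_setGap γ m)
  have key : ∀ F : Gaps → ℝ≥0∞, Measurable F → ∫⁻ g, F g ∂(gapLaw f) = _ := fun F hF =>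
    lintegral_infinitePi_update
      (fun γ : Loop => Measure.infinitePi fun _ : ℕ => expMeasure (f γ)) γ hF
  -- The whole gap sequence of `γ` is resampled on both sides, so that it becomes the variable of an
  -- inner product measure in which gap `m` can be resampled.
  rw [key H hH, key _ hH'.lintegral_prod_right']
  refine lintegral_congr fun g => ?_
  rw [lintegral_infinitePi_update (fun _ : ℕ => expMeasure (f γ)) m (by
    have := (measurable_update_pair (X := fun _ : Loop => ℕ → ℝ) γ).comp
      (measurable_const (a := g) |>.prodMk measurable_id)
    exact hH.comp this)]
  refine lintegral_congr fun s => lintegral_congr fun x => ?_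
  simp only [setGap, Function.update_self, Function.update_idem]

end Law

/-! ### The renewal bound -/

theorem expMeasure_eq (r : ℝ) : expMeasure r = volume.withDensity (exponentialPDF r) := rfl

theorem measurable_exponentialPDF (r : ℝ) : Measurable (exponentialPDF r) :=
  (measurable_exponentialPDFReal r).ennreal_ofReal

theorem expMeasure_Iic {r : ℝ} (hr : 0 < r) (x : ℝ) :
    expMeasure r (Set.Iic x) = ENNReal.ofReal (if 0 ≤ x then 1 - Real.exp (-(r * x)) else 0) := by
  have := isProbabilityMeasure_expMeasure hr
  rw [← cdf_expMeasure_eq hr, ofReal_cdf]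

/-- The renewal equation of the Poisson process: at `u ≥ 0` the first term has density `r * exp (-r
u)`, the second `r * (1 - exp (-r u))`, and they add up to the constant intensity `r`. -/
theorem lintegral_expMeasure_renewal {r : ℝ} (hr : 0 < r) {φ : ℝ → ℝ≥0∞} (hφ : Measurable φ) :
    ∫⁻ x, φ x ∂(expMeasure r) +
        ∫⁻ x, ENNReal.ofReal r * (∫⁻ t in Set.Ici 0, φ (x + t)) ∂(expMeasure r) =
      ENNReal.ofReal r * ∫⁻ t in Set.Ici 0, φ t := by
  have := isProbabilityMeasure_expMeasure hr
  have hind : Measurable fun p : ℝ × ℝ => (Set.Iic p.2).indicator (fun _ => φ p.2) p.1 := by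
    have : (fun p : ℝ × ℝ => (Set.Iic p.2).indicator (fun _ => φ p.2) p.1) =
        {p : ℝ × ℝ | p.1 ≤ p.2}.indicator fun p => φ p.2 := by
      ext p; simp [Set.indicator]
    rw [this]
    exact (hφ.comp measurable_snd).indicator (measurableSet_le measurable_fst measurable_snd)
  have h1 : ∀ x, ∫⁻ t in Set.Ici 0, φ (x + t) =
      ∫⁻ u, (Set.Iic u).indicator (fun _ => φ u) x := by
    intro x
    rw [← lintegral_indicator measurableSet_Ici,
      ← lintegral_add_left_eq_self (fun u => (Set.Iic u).indicator (fun _ => φ u) x) x]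
    refine lintegral_congr fun t => ?_
    simp [Set.indicator]
  have h2 : ∫⁻ x, (∫⁻ t in Set.Ici 0, φ (x + t)) ∂(expMeasure r) =
      ∫⁻ u, φ u * expMeasure r (Set.Iic u) := by
    rw [lintegral_congr h1, lintegral_lintegral_swap hind.aemeasurable]
    refine lintegral_congr fun u => ?_
    rw [lintegral_indicator measurableSet_Iic, setLIntegral_const]
  have hm : Measurable fun x => ∫⁻ t in Set.Ici 0, φ (x + t) := by
    simp_rw [h1]
    exact hind.lintegral_prod_right'
  have hm2 : Measurable fun u => expMeasure r (Set.Iic u) := by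
    simp_rw [expMeasure_Iic hr]
    exact (Measurable.ite measurableSet_Ici (by fun_prop) (by fun_prop)).ennreal_ofReal
  rw [lintegral_const_mul _ hm, h2, expMeasure_eq,
    lintegral_withDensity_eq_lintegral_mul _ (measurable_exponentialPDF r) hφ, ← expMeasure_eq,
    ← lintegral_const_mul (f := fun u => φ u * expMeasure r (Set.Iic u)) _ (hφ.mul hm2),
    ← lintegral_add_left
      ((measurable_exponentialPDF r).mul hφ), ← lintegral_const_mul _ hφ,
    ← lintegral_indicator measurableSet_Ici]
  refine lintegral_congr fun u => ?_
  simp only [Pi.mul_apply, expMeasure_Iic hr, exponentialPDF_eq, Set.indicator, Set.mem_Ici]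
  split_ifs with hu
  · rw [mul_comm (φ u), ← mul_assoc, ← add_mul, ← ENNReal.ofReal_mul hr.le,
      ← ENNReal.ofReal_add (by positivity)]
    · congr 2; ring
    · refine mul_nonneg hr.le (sub_nonneg.2 (Real.exp_le_one_iff.2 ?_))
      have := mul_nonneg hr.le hu
      linarith
  · simp

/-- The partial sums of the gaps from index `m` on form a Poisson process of intensity `f γ`
independent of `G`. Induction on the number of points, one application of the renewal equation each.
-/
theorem sum_lintegral_gap_le {f : Loop → ℝ} (hf : ∀ γ, 0 < f γ) (γ : Loop) (K : ℕ) :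
    ∀ (m : ℕ) (G : Gaps → ℝ → ℝ≥0∞), Measurable (Function.uncurry G) →
      (∀ g i x, m ≤ i → G (setGap g γ i x) = G g) →
      ∑ k ∈ Finset.range K, ∫⁻ g, G g (∑ i ∈ Finset.range (k + 1), g γ (m + i)) ∂(gapLaw f) ≤
        ∫⁻ g, ENNReal.ofReal (f γ) * (∫⁻ t in Set.Ici 0, G g t) ∂(gapLaw f) := by
  have := isProbabilityMeasure_gapLaw hf
  have := fun γ => isProbabilityMeasure_expMeasure (hf γ)
  induction K with
  | zero => intro m G _ _; simp
  | succ K ih =>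
    intro m G hG hind
    have hG1 : ∀ g, Measurable (G g) := fun g => hG.comp (measurable_const.prodMk measurable_id)
    have hgap : ∀ i, Measurable fun g : Gaps => g γ i := fun i => by fun_prop
    -- The first gap is absorbed into the function, which then ignores the gaps from index `m + 1`
    -- on.
    let G' : Gaps → ℝ → ℝ≥0∞ := fun g s => G g (g γ m + s)
    have hG' : Measurable (Function.uncurry G') :=
      hG.comp (measurable_fst.prodMk (((hgap m).comp measurable_fst).add measurable_snd))
    have ih' := ih (m + 1) G' hG' fun g i x hi => by
      funext s
      simp only [G']
      rw [hind g i x (by omega), setGap_of_ne_index g γ x (by omega)]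
    rw [Finset.sum_range_succ']
    have e1 : ∀ k (g : Gaps), G g (∑ i ∈ Finset.range (k + 1 + 1), g γ (m + i)) =
        G' g (∑ i ∈ Finset.range (k + 1), g γ (m + 1 + i)) := by
      intro k g
      rw [Finset.sum_range_succ', add_comm]
      simp only [G', add_zero]
      congr 2
      refine Finset.sum_congr rfl fun i _ => ?_
      congr 1; omega
    simp_rw [e1]
    refine (add_le_add_left ih' _).trans (le_of_eq ?_)
    have e2 : ∫⁻ g, G g (∑ i ∈ Finset.range (0 + 1), g γ (m + i)) ∂(gapLaw f) =
        ∫⁻ g, ∫⁻ x, G g x ∂(expMeasure (f γ)) ∂(gapLaw f) := by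
      simp only [zero_add, Finset.sum_range_one, add_zero]
      rw [lintegral_setGap hf γ m (H := fun g => G g (g γ m))
        (hG.comp (measurable_id.prodMk (hgap m)))]
      simp only [hind _ m _ le_rfl, setGap_same]
    have hmt : Measurable fun p : Gaps × ℝ => ∫⁻ t in Set.Ici 0, G p.1 (p.2 + t) := by
      have : Measurable fun q : (Gaps × ℝ) × ℝ => G q.1.1 (q.1.2 + q.2) :=
        hG.comp ((measurable_fst.comp measurable_fst).prodMk
          ((measurable_snd.comp measurable_fst).add measurable_snd))
      exact this.lintegral_prod_right'
    have e3 : ∫⁻ g, ENNReal.ofReal (f γ) * (∫⁻ t in Set.Ici 0, G' g t) ∂(gapLaw f) =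
        ∫⁻ g, ∫⁻ x, ENNReal.ofReal (f γ) * (∫⁻ t in Set.Ici 0, G g (x + t))
          ∂(expMeasure (f γ)) ∂(gapLaw f) := by
      rw [lintegral_setGap hf γ m
        (H := fun g => ENNReal.ofReal (f γ) * ∫⁻ t in Set.Ici 0, G g (g γ m + t))
        ((hmt.comp (measurable_id.prodMk (hgap m))).const_mul _)]
      simp only [hind _ m _ le_rfl, setGap_same]
    rw [e2, e3, add_comm,
      ← lintegral_add_left (f := fun g => ∫⁻ x, G g x ∂(expMeasure (f γ))) hG.lintegral_prod_right']
    exact lintegral_congr fun g => lintegral_expMeasure_renewal (hf γ) (hG1 g)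

/-! ### Almost sure properties of the ring times -/

section AlmostSure

variable {f : Loop → ℝ} (hf : ∀ γ, 0 < f γ)
include hf

theorem ae_gap_pos : ∀ᵐ g ∂(gapLaw f), ∀ γ k, 0 < g γ k := by
  rw [ae_all_iff]; intro γ
  rw [ae_all_iff]; intro k
  have hS : MeasurableSet {g : Gaps | g γ k ≤ 0} := measurableSet_le (by fun_prop) (by fun_prop)
  have : gapLaw f {g : Gaps | g γ k ≤ 0} = 0 := by
    rw [← lintegral_indicator_one hS,
      lintegral_setGap hf γ k (measurable_one.indicator hS)]
    have : ∀ g : Gaps, ∀ x, {g : Gaps | g γ k ≤ 0}.indicator (1 : Gaps → ℝ≥0∞) (setGap g γ k x) =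
        (Set.Iic 0).indicator 1 x := by
      intro g x; simp [Set.indicator]
    simp_rw [this]
    rw [lintegral_indicator_one measurableSet_Iic, expMeasure_Iic (hf γ)]
    simp
  rw [ae_iff]
  simpa using this

/-- Gap `0` of the loop of `a` is a summand of the time of `a` and does not enter that of `b`. Given
all other gaps, a tie forces it to a single value, and its law has no atoms. -/
theorem ae_gapTime_ne : ∀ᵐ g ∂(gapLaw f), ∀ a b : Loop × ℕ, a.1 ≠ b.1 →
    gapTime g a ≠ gapTime g b := by
  rw [ae_all_iff]; intro a
  rw [ae_all_iff]; intro b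
  rw [Filter.eventually_imp_distrib_left]; intro hab
  have hS : MeasurableSet {g : Gaps | gapTime g a = gapTime g b} :=
    measurableSet_eq_fun (by fun_prop) (by fun_prop)
  have : gapLaw f {g : Gaps | gapTime g a = gapTime g b} = 0 := by
    rw [← lintegral_indicator_one hS,
      lintegral_setGap hf a.1 0 (measurable_one.indicator hS)]
    have h1 : ∀ g : Gaps, ∀ x, {g : Gaps | gapTime g a = gapTime g b}.indicator
        (1 : Gaps → ℝ≥0∞) (setGap g a.1 0 x) =
        ({gapTime g b - ∑ i ∈ Finset.range a.2, g a.1 (i + 1)} : Set ℝ).indicator 1 x := by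
      intro g x
      have h2 : gapTime (setGap g a.1 0 x) a = ∑ i ∈ Finset.range a.2, g a.1 (i + 1) + x := by
        rw [gapTime, Finset.sum_range_succ', setGap_same]
        congr 1
        exact Finset.sum_congr rfl fun i _ => setGap_of_ne_index _ _ _ (by omega)
      have h3 : gapTime (setGap g a.1 0 x) b = gapTime g b := by
        rw [gapTime, gapTime, setGap_of_ne_loop g 0 x hab.symm]
      simp only [Set.indicator, Set.mem_ofPred_eq, h2, h3, Set.mem_singleton_iff, eq_sub_iff_add_eq,
        Pi.one_apply, add_comm x]
    simp_rw [h1]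
    have h4 : ∀ y, expMeasure (f a.1) {y} = 0 := fun y =>
      (withDensity_absolutelyContinuous _ _) (measure_singleton y)
    simp only [lintegral_indicator_one (measurableSet_singleton _), h4, lintegral_zero]
  rw [ae_iff]
  simpa using this

end AlmostSure

theorem gapTime_mono {g : Gaps} (hg : ∀ γ k, 0 < g γ k) (γ : Loop) :
    StrictMono fun k => gapTime g (γ, k) := by
  refine strictMono_nat_of_lt_succ fun k => ?_
  simp only [gapTime]
  rw [Finset.sum_range_succ _ (k + 1)]
  linarith [hg γ (k + 1)]

theorem gapTime_pos {g : Gaps} (hg : ∀ γ k, 0 < g γ k) (a : Loop × ℕ) : 0 < gapTime g a :=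
  Finset.sum_pos (fun i _ => hg a.1 i) ⟨0, by simp⟩

/-! ### Chains of rings -/

/-- A vertex of `V_γ` lies inside `γ'`. -/
def Linked (γ γ' : Loop) : Prop := ∃ u ∈ γ.vertices, γ'.Contains u

open Classical in
/-- The function `s ↦ exp (-θ s)` on `(0, ∞)`, extended by zero. -/
def expKernel (θ s : ℝ) : ℝ≥0∞ := if 0 < s then ENNReal.ofReal (Real.exp (-(θ * s))) else 0

@[fun_prop]
theorem measurable_expKernel (θ : ℝ) : Measurable (expKernel θ) :=
  Measurable.ite measurableSet_Ioi (by fun_prop) measurable_const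

theorem lintegral_expKernel_le {θ : ℝ} (hθ : 0 < θ) :
    ∫⁻ s, expKernel θ s ≤ ENNReal.ofReal θ⁻¹ := by
  calc ∫⁻ s, expKernel θ s ≤ ∫⁻ s, ENNReal.ofReal θ⁻¹ * exponentialPDF θ s := by
        refine lintegral_mono fun s => ?_
        rw [expKernel]
        split_ifs with hs
        · rw [exponentialPDF_of_nonneg hs.le, ← ENNReal.ofReal_mul (by positivity), ← mul_assoc,
            inv_mul_cancel₀ hθ.ne', one_mul]
        · exact zero_le
    _ = ENNReal.ofReal θ⁻¹ := by
        rw [lintegral_const_mul _ (measurable_exponentialPDF θ), lintegral_exponentialPDF_eq_one hθ,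
          mul_one]

open Classical in
/-- The weight `exp (-θ t)` of a chain of rings that ends with the ring `a` at time `t`, and in
which the loops of successive rings are linked and the times of the rings decrease; the weight is
zero for other sequences of rings. -/
def chainWeight (θ : ℝ) (g : Gaps) : Loop × ℕ → List (Loop × ℕ) → ℝ≥0∞
  | a, [] => expKernel θ (gapTime g a)
  | a, b :: l => (if Linked a.1 b.1 then 1 else 0) *
      (chainWeight θ g b l * expKernel θ (gapTime g a - gapTime g b))

theorem measurable_chainWeight (θ : ℝ) (a : Loop × ℕ) (l : List (Loop × ℕ)) :
    Measurable fun g => chainWeight θ g a l := by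
  induction l generalizing a with
  | nil => exact (measurable_expKernel θ).comp (measurable_gapTime a)
  | cons b l ih =>
    exact ((ih b).mul ((measurable_expKernel θ).comp
      ((measurable_gapTime a).sub (measurable_gapTime b)))).const_mul _

open Classical in
/-- A bound for the indices of the rings of `γ` in a list. -/
def indexBound (γ : Loop) : List (Loop × ℕ) → ℕ
  | [] => 0
  | a :: l => max (if a.1 = γ then a.2 + 1 else 0) (indexBound γ l)

theorem gapTime_setGap {γ : Loop} {a : Loop × ℕ} {l : List (Loop × ℕ)} {i : ℕ}
    (hi : indexBound γ (a :: l) ≤ i) (g : Gaps) (x : ℝ) :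
    gapTime (setGap g γ i x) a = gapTime g a := by
  by_cases h : a.1 = γ
  · have h1 : a.2 + 1 ≤ i := le_trans (by simp [indexBound, h]) hi
    subst h
    refine Finset.sum_congr rfl fun j hj => setGap_of_ne_index _ _ _ ?_
    rw [Finset.mem_range] at hj
    omega
  · simp only [gapTime, setGap_of_ne_loop g i x h]

theorem chainWeight_setGap {γ : Loop} {a : Loop × ℕ} {l : List (Loop × ℕ)} {i : ℕ}
    (hi : indexBound γ (a :: l) ≤ i) (θ : ℝ) (g : Gaps) (x : ℝ) :
    chainWeight θ (setGap g γ i x) a l = chainWeight θ g a l := by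
  induction l generalizing a with
  | nil => rw [chainWeight, chainWeight, gapTime_setGap hi]
  | cons b l ih =>
    have hi' : indexBound γ (b :: l) ≤ i := (le_max_right _ _).trans hi
    rw [chainWeight, chainWeight, gapTime_setGap hi, gapTime_setGap hi', ih hi']

-- Such a ring is no later than some ring of `γ` in the list, and times decrease along a list of
-- nonzero weight.
open Classical in
theorem gapTime_le_of_lt_indexBound {g : Gaps} (hg : ∀ γ k, 0 < g γ k) {γ : Loop} {θ : ℝ}
    {a : Loop × ℕ} {l : List (Loop × ℕ)} {k : ℕ} (hk : k < indexBound γ (a :: l))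
    (hw : chainWeight θ g a l ≠ 0) : gapTime g (γ, k) ≤ gapTime g a := by
  have key : ∀ a : Loop × ℕ, k < (if a.1 = γ then a.2 + 1 else 0) →
      gapTime g (γ, k) ≤ gapTime g a := by
    rintro ⟨γ', j⟩ h
    split_ifs at h with h1
    · obtain rfl : γ' = γ := h1
      exact (gapTime_mono hg γ').monotone (Nat.lt_succ_iff.1 h)
    · omega
  induction l generalizing a with
  | nil =>
    refine key a ?_
    simpa [indexBound] using hk
  | cons b l ih =>
    rw [indexBound, lt_max_iff] at hk
    rcases hk with hk | hk
    · exact key a hk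
    · rw [chainWeight, mul_ne_zero_iff, mul_ne_zero_iff] at hw
      refine (ih hk hw.2.1).trans ?_
      have := hw.2.2
      rw [expKernel, ne_eq, ite_eq_right_iff, Classical.not_imp] at this
      linarith [this.1]

/-- Here `W` is the weight of the rest of a chain and `τ` the time of its latest ring. Rings of `γ`
with index below `m` are not after `τ`, so the kernel kills them; the later ones are driven by gaps
independent of `W` and `τ`, and the renewal bound applies. -/
theorem tsum_lintegral_expKernel_le {f : Loop → ℝ} (hf : ∀ γ, 0 < f γ) {θ : ℝ} (hθ : 0 < θ)
    (γ : Loop) (m : ℕ) {W : Gaps → ℝ≥0∞} {τ : Gaps → ℝ} (hW : Measurable W) (hτ : Measurable τ)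
    (hW' : ∀ g i x, m ≤ i → W (setGap g γ i x) = W g)
    (hτ' : ∀ g i x, m ≤ i → τ (setGap g γ i x) = τ g)
    (hm : ∀ g : Gaps, (∀ γ k, 0 < g γ k) → ∀ k < m, W g ≠ 0 → gapTime g (γ, k) ≤ τ g) :
    ∑' k, ∫⁻ g, W g * expKernel θ (gapTime g (γ, k) - τ g) ∂(gapLaw f) ≤
      ENNReal.ofReal (f γ) * ENNReal.ofReal θ⁻¹ * ∫⁻ g, W g ∂(gapLaw f) := by
  let β : Gaps → ℝ := fun g => ∑ i ∈ Finset.range m, g γ i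
  have hβ : Measurable β := by fun_prop
  let G : Gaps → ℝ → ℝ≥0∞ := fun g t => W g * expKernel θ (t + (β g - τ g))
  refine ENNReal.tsum_le_of_sum_range_le fun K => ?_
  calc _ ≤ ∑ k ∈ Finset.range (m + K),
        ∫⁻ g, W g * expKernel θ (gapTime g (γ, k) - τ g) ∂(gapLaw f) :=
      Finset.sum_le_sum_of_subset (Finset.range_mono (Nat.le_add_left K m))
    _ = ∑ k ∈ Finset.range K,
        ∫⁻ g, G g (∑ i ∈ Finset.range (k + 1), g γ (m + i)) ∂(gapLaw f) := by
      rw [Finset.sum_range_add, Finset.sum_eq_zero, zero_add]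
      · refine Finset.sum_congr rfl fun k _ => lintegral_congr fun g => ?_
        simp only [G, β, gapTime]
        rw [add_assoc m k 1, Finset.sum_range_add]
        congr 2; ring
      · intro k hk
        refine (lintegral_eq_zero_iff (hW.mul ((measurable_expKernel θ).comp
          ((measurable_gapTime _).sub hτ)))).2 ?_
        filter_upwards [ae_gap_pos hf] with g hg
        by_cases hw : W g = 0
        · simp only [Pi.mul_apply, hw, zero_mul, Pi.zero_apply]
        · have := hm g hg k (Finset.mem_range.1 hk) hw
          simp only [Pi.mul_apply, Function.comp_apply, Pi.sub_apply, Pi.zero_apply]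
          rw [expKernel, if_neg (by linarith), mul_zero]
    _ ≤ ∫⁻ g, ENNReal.ofReal (f γ) * (∫⁻ t in Set.Ici 0, G g t) ∂(gapLaw f) := by
      refine sum_lintegral_gap_le hf γ K m G ?_ ?_
      · exact (hW.comp measurable_fst).mul ((measurable_expKernel θ).comp
          (measurable_snd.add ((hβ.sub hτ).comp measurable_fst)))
      · intro g i x hi
        have : β (setGap g γ i x) = β g := by
          refine Finset.sum_congr rfl fun j hj => setGap_of_ne_index _ _ _ ?_
          rw [Finset.mem_range] at hj
          omega
        simp only [G, hW' g i x hi, hτ' g i x hi, this]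
    _ ≤ ∫⁻ g, ENNReal.ofReal (f γ) * (W g * ENNReal.ofReal θ⁻¹) ∂(gapLaw f) := by
      refine lintegral_mono fun g => ?_
      gcongr
      refine (setLIntegral_le_lintegral _ _).trans ?_
      simp only [G]
      rw [lintegral_const_mul _ (by fun_prop),
        lintegral_add_right_eq_self (expKernel θ) (β g - τ g)]
      gcongr
      exact lintegral_expKernel_le hθ
    _ = _ := by
      rw [lintegral_const_mul _ (hW.mul_const _), lintegral_mul_const _ hW]
      ring

/-! ### Expected weight of chains -/

/-- The expected total weight of the chains of length `n + 1` that end with a ring of `γ`. -/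
def chainMass (f : Loop → ℝ) (θ : ℝ) (n : ℕ) (γ : Loop) : ℝ≥0∞ :=
  ∑' k, ∑' l : {l : List (Loop × ℕ) // l.length = n},
    ∫⁻ g, chainWeight θ g (γ, k) l ∂(gapLaw f)

/-- A list of length `n + 1` is an element and a list of length `n`. -/
def consEquiv (α : Type*) (n : ℕ) :
    α × {l : List α // l.length = n} ≃ {l : List α // l.length = n + 1} where
  toFun p := ⟨p.1 :: p.2.1, by simp [p.2.2]⟩
  invFun l := ⟨l.1.head (by rintro h; simpa [h] using l.2), ⟨l.1.tail, by simp [l.2]⟩⟩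
  left_inv p := by simp
  right_inv l := by simp

section Mass

variable {f : Loop → ℝ} (hf : ∀ γ, 0 < f γ) {θ : ℝ} (hθ : 0 < θ)
include hf hθ

theorem chainMass_zero_le (γ : Loop) :
    chainMass f θ 0 γ ≤ ENNReal.ofReal (f γ) * ENNReal.ofReal θ⁻¹ := by
  have := isProbabilityMeasure_gapLaw hf
  have h := tsum_lintegral_expKernel_le hf hθ γ 0 (W := fun _ => 1) (τ := fun _ => 0)
    measurable_const measurable_const (fun _ _ _ _ => rfl) (fun _ _ _ _ => rfl)
    (fun _ _ k hk => absurd hk (Nat.not_lt_zero k))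
  simp only [one_mul, sub_zero, lintegral_one, measure_univ, mul_one] at h
  refine le_trans (le_of_eq (tsum_congr fun k => ?_)) h
  rw [tsum_eq_single ⟨[], rfl⟩]
  · rfl
  · rintro ⟨l, hl⟩ h
    exact absurd (Subtype.ext (List.length_eq_zero_iff.1 hl)) h

-- The index `k` of the latest ring is summed first, with the rest of the chain fixed; `indexBound`
-- separates the gaps which the rest may depend on.
open Classical in
theorem chainMass_succ_le (n : ℕ) (γ : Loop) :
    chainMass f θ (n + 1) γ ≤ ENNReal.ofReal (f γ) * ENNReal.ofReal θ⁻¹ *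
      ∑' γ', (if Linked γ γ' then 1 else 0) * chainMass f θ n γ' := by
  have h1 : ∀ k, ∑' l : {l : List (Loop × ℕ) // l.length = n + 1},
      ∫⁻ g, chainWeight θ g (γ, k) l ∂(gapLaw f) =
      ∑' p : (Loop × ℕ) × {l : List (Loop × ℕ) // l.length = n},
        (if Linked γ p.1.1 then 1 else 0) * ∫⁻ g, chainWeight θ g p.1 p.2 *
          expKernel θ (gapTime g (γ, k) - gapTime g p.1) ∂(gapLaw f) := by
    intro k
    rw [← (consEquiv (Loop × ℕ) n).tsum_eq]
    refine tsum_congr fun p => ?_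
    simp only [consEquiv, Equiv.coe_fn_mk, chainWeight]
    rw [lintegral_const_mul]
    exact (measurable_chainWeight θ _ _).mul ((measurable_expKernel θ).comp
      ((measurable_gapTime _).sub (measurable_gapTime _)))
  calc chainMass f θ (n + 1) γ = ∑' p : (Loop × ℕ) × {l : List (Loop × ℕ) // l.length = n},
        (if Linked γ p.1.1 then 1 else 0) * ∑' k, ∫⁻ g, chainWeight θ g p.1 p.2 *
          expKernel θ (gapTime g (γ, k) - gapTime g p.1) ∂(gapLaw f) := by
        rw [chainMass, tsum_congr h1, ENNReal.tsum_comm]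
        exact tsum_congr fun p => ENNReal.tsum_mul_left
    _ ≤ ∑' p : (Loop × ℕ) × {l : List (Loop × ℕ) // l.length = n},
        (if Linked γ p.1.1 then 1 else 0) * (ENNReal.ofReal (f γ) * ENNReal.ofReal θ⁻¹ *
          ∫⁻ g, chainWeight θ g p.1 p.2 ∂(gapLaw f)) := by
        refine ENNReal.tsum_le_tsum fun p => ?_
        gcongr
        exact tsum_lintegral_expKernel_le hf hθ γ (indexBound γ (p.1 :: p.2))
          (measurable_chainWeight θ _ _) (measurable_gapTime _)
          (fun g i x hi => chainWeight_setGap hi θ g x) (fun g i x hi => gapTime_setGap hi g x)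
          (fun g hg k hk hw => gapTime_le_of_lt_indexBound hg hk hw)
    _ = _ := by
        rw [ENNReal.tsum_prod', ENNReal.tsum_prod', ← ENNReal.tsum_mul_left]
        refine tsum_congr fun γ' => ?_
        rw [chainMass, ← ENNReal.tsum_mul_left, ← ENNReal.tsum_mul_left]
        refine tsum_congr fun k => ?_
        rw [← ENNReal.tsum_mul_left, ← ENNReal.tsum_mul_left]
        exact tsum_congr fun l => by ring

open Classical in
theorem tsum_chainMass_le (hproper : Proper f) (n : ℕ) (v : ℤ × ℤ) :
    ∑' γ : {γ : Loop // γ.Contains v}, chainMass f θ n γ ≤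
      (totalWeight f * ENNReal.ofReal θ⁻¹) ^ (n + 1) := by
  induction n generalizing v with
  | zero =>
    calc _ ≤ ∑' γ : {γ : Loop // γ.Contains v},
          ENNReal.ofReal (f γ) * (γ.1.size : ℝ≥0∞) * ENNReal.ofReal θ⁻¹ := by
          refine ENNReal.tsum_le_tsum fun γ => (chainMass_zero_le hf hθ γ.1).trans ?_
          gcongr
          -- The factor `S_γ` is not needed for chains of one ring; it is at least `1` because `v`
          -- belongs to `V_γ`.
          refine le_mul_of_one_le_right' ?_
          have : (1 : ℕ∞) ≤ γ.1.size := Set.one_le_encard_iff_nonempty.2 ⟨v, Or.inl γ.2⟩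
          exact_mod_cast this
      _ ≤ _ := by
          rw [ENNReal.tsum_mul_right, zero_add, pow_one]
          gcongr
          exact tsum_contains_le hproper v
  | succ n ih =>
    set D := (totalWeight f * ENNReal.ofReal θ⁻¹) ^ (n + 1) with hD
    have h1 : ∀ γ : Loop, ∑' γ', (if Linked γ γ' then 1 else 0) * chainMass f θ n γ' ≤
        γ.size * D := by
      intro γ
      -- Union bound over the linking vertex; the induction hypothesis is uniform in that vertex.
      calc _ ≤ ∑' γ', ∑' u : γ.vertices, (if γ'.Contains u then chainMass f θ n γ' else 0) := by
            refine ENNReal.tsum_le_tsum fun γ' => ?_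
            split_ifs with h
            · obtain ⟨u, hu, hu'⟩ := h
              refine le_trans ?_ (ENNReal.le_tsum ⟨u, hu⟩)
              simp [hu']
            · simp
        _ = ∑' u : γ.vertices, ∑' γ' : {γ' : Loop // γ'.Contains u}, chainMass f θ n γ' := by
            rw [ENNReal.tsum_comm]
            refine tsum_congr fun u => ?_
            exact (tsum_subtype {γ' : Loop | γ'.Contains u} (chainMass f θ n)).symm ▸ rfl
        _ ≤ ∑' u : γ.vertices, D := ENNReal.tsum_le_tsum fun u => ih u
        _ = _ := ENNReal.tsum_set_const _ _
    calc _ ≤ ∑' γ : {γ : Loop // γ.Contains v},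
          ENNReal.ofReal (f γ) * (γ.1.size : ℝ≥0∞) * (ENNReal.ofReal θ⁻¹ * D) := by
          refine ENNReal.tsum_le_tsum fun γ => (chainMass_succ_le hf hθ n γ.1).trans ?_
          calc _ ≤ ENNReal.ofReal (f γ) * ENNReal.ofReal θ⁻¹ * (γ.1.size * D) := by
                gcongr; exact h1 γ.1
            _ = _ := by ring
      _ ≤ totalWeight f * (ENNReal.ofReal θ⁻¹ * D) := by
          rw [ENNReal.tsum_mul_right]
          gcongr
          exact tsum_contains_le hproper v
      _ = _ := by rw [hD, pow_succ _ (n + 1)]; ring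

end Mass

/-! ### Almost sure finiteness of chains -/

/-- The list `a :: l` of rings is a chain: the times decrease and successive loops are linked. -/
def IsRingChain (g : Gaps) (a : Loop × ℕ) (l : List (Loop × ℕ)) : Prop :=
  (a :: l).IsChain fun a b => gapTime g b < gapTime g a ∧ Linked a.1 b.1

/-- The exponents telescope. -/
theorem chainWeight_eq {g : Gaps} (hg : ∀ γ k, 0 < g γ k) (θ : ℝ) {a : Loop × ℕ}
    {l : List (Loop × ℕ)} (h : IsRingChain g a l) :
    chainWeight θ g a l = ENNReal.ofReal (Real.exp (-(θ * gapTime g a))) := by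
  induction l generalizing a with
  | nil => rw [chainWeight, expKernel, if_pos (gapTime_pos hg a)]
  | cons b l ih =>
    rw [IsRingChain, List.isChain_cons_cons] at h
    rw [chainWeight, if_pos h.1.2, ih h.2, expKernel, if_pos (by linarith [h.1.1]), one_mul,
      ← ENNReal.ofReal_mul (Real.exp_nonneg _), ← Real.exp_add]
    congr 2; ring

theorem ae_finite_chains {f : Loop → ℝ} (hf : ∀ γ, 0 < f γ) (hproper : Proper f)
    (hsum : totalWeight f < ∞) :
    ∀ᵐ g ∂(gapLaw f), ∀ (v : ℤ × ℤ) (T : ℝ),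
      {p : (Loop × ℕ) × List (Loop × ℕ) |
        p.1.1.Contains v ∧ gapTime g p.1 ≤ T ∧ IsRingChain g p.1 p.2}.Finite := by
  rw [ae_all_iff]; intro v
  set C := (totalWeight f).toReal with hC
  have hC0 : 0 ≤ C := ENNReal.toReal_nonneg
  -- Any `θ > C` makes the ratio `q = C / θ` less than `1`; adding `1` also keeps `θ` positive if `C
  -- = 0`.
  set θ := C + 1 with hθ'
  have hθ : 0 < θ := by positivity
  set q := totalWeight f * ENNReal.ofReal θ⁻¹ with hq
  have hq1 : q < 1 := by
    rw [hq, ← ENNReal.ofReal_toReal hsum.ne, ← ENNReal.ofReal_mul hC0, ENNReal.ofReal_lt_one,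
      ← div_eq_mul_inv, div_lt_one hθ]
    linarith
  have hmeas : ∀ p : {γ : Loop // γ.Contains v} × ℕ × List (Loop × ℕ),
      Measurable fun g => chainWeight θ g (p.1.1, p.2.1) p.2.2 :=
    fun p => measurable_chainWeight θ _ _
  have hfin : ∫⁻ g, ∑' p : {γ : Loop // γ.Contains v} × ℕ × List (Loop × ℕ),
      chainWeight θ g (p.1.1, p.2.1) p.2.2 ∂(gapLaw f) ≠ ∞ := by
    rw [lintegral_tsum fun p => (hmeas p).aemeasurable, ENNReal.tsum_prod']
    have h1 : ∀ γ : {γ : Loop // γ.Contains v}, ∑' p : ℕ × List (Loop × ℕ),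
        ∫⁻ g, chainWeight θ g (γ.1, p.1) p.2 ∂(gapLaw f) = ∑' n, chainMass f θ n γ.1 := by
      intro γ
      rw [ENNReal.tsum_prod']
      simp only [chainMass]
      rw [ENNReal.tsum_comm (f := fun n k => ∑' l : {l : List (Loop × ℕ) // l.length = n},
        ∫⁻ g, chainWeight θ g (γ.1, k) l ∂(gapLaw f))]
      refine tsum_congr fun k => ?_
      rw [← (Equiv.sigmaFiberEquiv (List.length (α := Loop × ℕ))).tsum_eq, ENNReal.tsum_sigma']
      rfl
    rw [tsum_congr h1, ENNReal.tsum_comm]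
    refine ne_top_of_le_ne_top ?_ (ENNReal.tsum_le_tsum fun n => tsum_chainMass_le hf hθ hproper n v)
    rw [← hq]
    simp only [pow_succ']
    rw [ENNReal.tsum_mul_left, ENNReal.tsum_geometric]
    refine ENNReal.mul_ne_top (hq1.trans ENNReal.one_lt_top).ne (ENNReal.inv_ne_top.2 ?_)
    exact (tsub_pos_of_lt hq1).ne'
  filter_upwards [ae_lt_top (Measurable.tsum hmeas) hfin, ae_gap_pos hf] with g hg hpos T
  -- Each chain ending by time `T` weighs at least `exp (-θ T)`, and a finite sum has only finitely
  -- many such terms. The exceptional null set does not depend on `T`.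
  have h2 := ENNReal.finite_const_le_of_tsum_ne_top hg.ne
    (ε := ENNReal.ofReal (Real.exp (-(θ * T)))) (by simp [Real.exp_pos])
  refine (h2.image fun p => (((p.1.1, p.2.1) : Loop × ℕ), p.2.2)).subset ?_
  rintro ⟨⟨γ, k⟩, l⟩ ⟨h3, h4, h5⟩
  refine ⟨(⟨γ, h3⟩, k, l), ?_, rfl⟩
  simp only [Set.mem_ofPred_eq]
  rw [chainWeight_eq hpos θ h5]
  refine ENNReal.ofReal_le_ofReal (Real.exp_le_exp.2 (neg_le_neg ?_))
  exact mul_le_mul_of_nonneg_left h4 hθ.le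

/-! ### The dynamics for regular ring times -/

/-- The ring `b` may influence the ring `a`. -/
def Influences (g : Gaps) (b a : Loop × ℕ) : Prop :=
  gapTime g b < gapTime g a ∧ Linked a.1 b.1

/-- The almost sure properties of the ring times which make the dynamics well defined. -/
structure IsRegular (g : Gaps) : Prop where
  pos : ∀ a, 0 < gapTime g a
  injective : Function.Injective (gapTime g)
  finite : ∀ (v : ℤ × ℤ) (t : ℝ), {a : Loop × ℕ | a.1.Contains v ∧ gapTime g a ≤ t}.Finite
  wf : WellFounded (Influences g)

theorem wellFounded_influences {g : Gaps}
    (h : ∀ (v : ℤ × ℤ) (T : ℝ), {p : (Loop × ℕ) × List (Loop × ℕ) |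
        p.1.1.Contains v ∧ gapTime g p.1 ≤ T ∧ IsRingChain g p.1 p.2}.Finite) :
    WellFounded (Influences g) := by
  rw [wellFounded_iff_isEmpty_descending_chain]
  refine ⟨fun ⟨s, hs⟩ => ?_⟩
  -- `L n i` lists `s i, …, s (i + n - 1)`. These segments of an infinite descending sequence give
  -- chains of every length from the same ring.
  let L : ℕ → ℕ → List (Loop × ℕ) := fun n =>
    Nat.rec (fun _ => []) (fun _ r i => s i :: r (i + 1)) n
  have hL0 : ∀ i, L 0 i = [] := fun _ => rfl
  have hL1 : ∀ n i, L (n + 1) i = s i :: L n (i + 1) := fun _ _ => rfl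
  have hlen : ∀ n i, (L n i).length = n := by
    intro n
    induction n with
    | zero => intro i; rfl
    | succ n ih => intro i; rw [hL1, List.length_cons, ih]
  have hchain : ∀ n i, IsRingChain g (s i) (L n (i + 1)) := by
    intro n
    induction n with
    | zero => intro i; rw [hL0]; exact List.isChain_singleton _
    | succ n ih => intro i; rw [hL1]; exact List.isChain_cons_cons.2 ⟨hs i, ih (i + 1)⟩
  -- The link from `s 0` provides a vertex inside the loop of `s 1`, so the chains are started at `s
  -- 1`; no vertex inside the loop of `s 0` is at hand.
  obtain ⟨u, -, hu⟩ := (hs 0).2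
  refine Set.infinite_of_injective_forall_mem (f := fun n => (s 1, L n 2)) ?_ ?_
    (h u (gapTime g (s 1)))
  · intro n m hnm
    rw [← hlen n 2, ← hlen m 2, (Prod.mk.inj hnm).2]
  · exact fun n => ⟨hu, le_rfl, hchain n 1⟩

theorem ae_isRegular {f : Loop → ℝ} (hf : ∀ γ, 0 < f γ) (hproper : Proper f)
    (hsum : totalWeight f < ∞) : ∀ᵐ g ∂(gapLaw f), IsRegular g := by
  filter_upwards [ae_gap_pos hf, ae_gapTime_ne hf, ae_finite_chains hf hproper hsum] with g h1 h2 h3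
  refine ⟨gapTime_pos h1, ?_, fun v t => ?_, wellFounded_influences h3⟩
  · rintro ⟨γ, k⟩ ⟨γ', k'⟩ h
    by_cases hγ : γ = γ'
    · subst hγ
      rw [(gapTime_mono h1 γ).injective h]
    · exact absurd h (h2 _ _ hγ)
  · refine Set.Finite.of_finite_image (f := fun a => (a, ([] : List (Loop × ℕ)))) ?_
      fun a _ b _ h => (Prod.mk.inj h).1
    refine (h3 v t).subset ?_
    rintro _ ⟨a, ha, rfl⟩
    exact ⟨ha.1, ha.2, List.isChain_singleton _⟩

open Classical in
/-- The factor `-1` for a flip and `1` otherwise. -/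
def flipSign (p : Prop) : ℤˣ := if p then -1 else 1

/-- The rings of loops containing `v` before time `t`. -/
def ringsBefore (g : Gaps) (t : ℝ) (v : ℤ × ℤ) : Set (Loop × ℕ) :=
  {a | a.1.Contains v ∧ gapTime g a < t}

/-- The rings of loops containing `v` up to time `t`. -/
def ringsUpTo (g : Gaps) (t : ℝ) (v : ℤ × ℤ) : Set (Loop × ℕ) :=
  {a | a.1.Contains v ∧ gapTime g a ≤ t}

/-- The configuration obtained from `σ₀` if at `v` the rings in `A v` are taken into account and `b`
are the rings with a flip. -/
def configOf (σ₀ : Config) (b : Loop × ℕ → Prop) (A : ℤ × ℤ → Set (Loop × ℕ)) : Config :=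
  fun v => σ₀ v * ∏ᶠ a ∈ A v, flipSign (b a)

/-- There is a flip at the ring `a` if the flips before are given by `b`. -/
def FlipsAt (ϖ : Sample) (b : Loop × ℕ → Prop) (a : Loop × ℕ) : Prop :=
  Flips ϖ.1 a.1 (configOf ϖ.2.1 b (ringsBefore ϖ.2.2.1 (gapTime ϖ.2.2.1 a))) (ϖ.2.2.2 a.1 a.2)

theorem spinProduct_congr {σ σ' : Config} {z : Sym2 (ℤ × ℤ)} (h : ∀ u ∈ z, σ u = σ' u) :
    spinProduct σ z = spinProduct σ' z := by
  induction z with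
  | h x y => simp only [spinProduct, Sym2.lift_mk, h x (by simp), h y (by simp)]

theorem flips_congr {J : Coupling} {γ : Loop} {σ σ' : Config} {c : Bool}
    (h : ∀ d ∈ γ.edges, ∀ u ∈ primalEdge d, σ u = σ' u) : Flips J γ σ c ↔ Flips J γ σ' c := by
  have : loopEnergy J γ σ = loopEnergy J γ σ' := by
    unfold loopEnergy
    congr 1
    exact Finset.sum_congr rfl fun d _ => by rw [spinProduct_congr (h d.1 d.2)]
  rw [Flips, Flips, this]

theorem influences_of_mem_ringsBefore {g : Gaps} {a c : Loop × ℕ} {u : ℤ × ℤ} {d : Sym2 (ℤ × ℤ)}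
    (hd : d ∈ a.1.edges) (hu : u ∈ primalEdge d) (hc : c ∈ ringsBefore g (gapTime g a) u) :
    Influences g c a :=
  ⟨hc.2, u, Or.inr ⟨d, hd, hu⟩, hc.1⟩

/-- The decision at `a` reads only spins next to its loop, and the earlier rings that could have
changed them all influence `a`. This is what makes the flip equation a recursion. -/
theorem flipsAt_congr {ϖ : Sample} {b b' : Loop × ℕ → Prop} {a : Loop × ℕ}
    (h : ∀ c, Influences ϖ.2.2.1 c a → (b c ↔ b' c)) : FlipsAt ϖ b a ↔ FlipsAt ϖ b' a := by
  refine flips_congr fun d hd u hu => ?_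
  simp only [configOf]
  congr 1
  exact finprod_mem_congr rfl fun c hc => by rw [h c (influences_of_mem_ringsBefore hd hu hc)]

namespace IsRegular

variable {g : Gaps} (hg : IsRegular g)
include hg

theorem finite_ringsUpTo (t : ℝ) (v : ℤ × ℤ) : (ringsUpTo g t v).Finite := hg.finite v t

theorem finite_ringsBefore (t : ℝ) (v : ℤ × ℤ) : (ringsBefore g t v).Finite :=
  (hg.finite v t).subset fun _ h => ⟨h.1, h.2.le⟩

/-- Only finitely many rings precede `t` at `v`, so there is a last one; this gives the left limits
of the spins. -/
theorem eventually_ringsUpTo_eq (t : ℝ≥0) (v : ℤ × ℤ) :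
    ∀ᶠ s : ℝ≥0 in 𝓝[<] t, ringsUpTo g s v = ringsBefore g t v := by
  have h1 : ∀ᶠ s : ℝ≥0 in 𝓝[<] t, ∀ a ∈ ringsBefore g t v, gapTime g a ≤ s := by
    rw [Filter.eventually_all_finite (hg.finite_ringsBefore t v)]
    intro a ha
    have h2 : (⟨gapTime g a, (hg.pos a).le⟩ : ℝ≥0) < t := NNReal.coe_lt_coe.1 ha.2
    filter_upwards [nhdsWithin_le_nhds (Ioi_mem_nhds h2)] with s hs
    exact NNReal.coe_le_coe.2 (le_of_lt hs)
  filter_upwards [h1, self_mem_nhdsWithin] with s hs hst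
  ext a
  exact ⟨fun h => ⟨h.1, h.2.trans_lt (NNReal.coe_lt_coe.2 hst)⟩, fun h => ⟨h.1, hs a h⟩⟩

theorem ringsUpTo_gapTime {a : Loop × ℕ} {v : ℤ × ℤ} (hv : a.1.Contains v) :
    ringsUpTo g (gapTime g a) v = insert a (ringsBefore g (gapTime g a) v) := by
  ext c
  simp only [ringsUpTo, ringsBefore, Set.mem_insert_iff, Set.mem_ofPred_eq]
  constructor
  · rintro ⟨h1, h2⟩
    rcases h2.lt_or_eq with h | h
    · exact Or.inr ⟨h1, h⟩
    · exact Or.inl (hg.injective h)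
  · rintro (rfl | ⟨h1, h2⟩)
    · exact ⟨hv, le_rfl⟩
    · exact ⟨h1, h2.le⟩

theorem configOf_ringsUpTo {a : Loop × ℕ} {v : ℤ × ℤ} (hv : a.1.Contains v) (σ₀ : Config)
    (b : Loop × ℕ → Prop) :
    configOf σ₀ b (ringsUpTo g (gapTime g a)) v =
      configOf σ₀ b (ringsBefore g (gapTime g a)) v * flipSign (b a) := by
  simp only [configOf]
  rw [hg.ringsUpTo_gapTime hv, finprod_mem_insert _ (fun h => lt_irrefl _ h.2)
    (hg.finite_ringsBefore _ v), mul_assoc, mul_comm (flipSign _)]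

end IsRegular

/-! ### Evolutions and solutions of the flip recursion -/

theorem isEvolution_configOf {ϖ : Sample} (hg : IsRegular ϖ.2.2.1) {b : Loop × ℕ → Prop}
    (hb : ∀ a, b a ↔ FlipsAt ϖ b a) :
    IsEvolution ϖ fun t => configOf ϖ.2.1 b (ringsUpTo ϖ.2.2.1 t) where
  initial := by
    funext v
    have : ringsUpTo ϖ.2.2.1 ((0 : ℝ≥0) : ℝ) v = ∅ :=
      Set.eq_empty_of_forall_notMem fun a ha => absurd (hg.pos a) (not_lt.2 ha.2)
    simp only [configOf, this, finprod_mem_empty, mul_one]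
  constant v s t hst h := by
    have : ringsUpTo ϖ.2.2.1 t v = ringsUpTo ϖ.2.2.1 s v := by
      ext a
      refine ⟨fun ha => ⟨ha.1, ?_⟩, fun ha => ⟨ha.1, ha.2.trans (NNReal.coe_le_coe.2 hst)⟩⟩
      by_contra hlt
      exact h a.1 a.2 ha.1 ⟨not_le.1 hlt, ha.2⟩
    simp only [configOf, this]
  ring γ k t ht := by
    have ht' : (t : ℝ) = gapTime ϖ.2.2.1 (γ, k) := ht
    refine ⟨configOf ϖ.2.1 b (ringsBefore ϖ.2.2.1 t), fun v => ?_, fun h v hv => ?_,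
      fun h v hv => ?_⟩
    · filter_upwards [hg.eventually_ringsUpTo_eq t v] with s hs
      simp only [configOf, hs]
    · rw [ht'] at h ⊢
      rw [hg.configOf_ringsUpTo (a := (γ, k)) hv, flipSign, if_pos ((hb (γ, k)).2 h), mul_neg_one]
    · rw [ht'] at h ⊢
      rw [hg.configOf_ringsUpTo (a := (γ, k)) hv, flipSign, if_neg (mt (hb (γ, k)).1 h), mul_one]

/-- The flips `b'` that the path performs determine it, since a spin changes only at the rings
around it. Hence `b'` solves the same recursion as `b`, and well-founded induction identifies them.
-/
theorem IsEvolution.eq_configOf {ϖ : Sample} (hg : IsRegular ϖ.2.2.1) {b : Loop × ℕ → Prop}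
    (hb : ∀ a, b a ↔ FlipsAt ϖ b a) {σ : ℝ≥0 → Config} (hσ : IsEvolution ϖ σ) :
    σ = fun t : ℝ≥0 => configOf ϖ.2.1 b (ringsUpTo ϖ.2.2.1 t) := by
  set g := ϖ.2.2.1 with hgdef
  let τ : Loop × ℕ → ℝ≥0 := fun a => ⟨gapTime g a, (hg.pos a).le⟩
  have hτ : ∀ a, (τ a : ℝ) = gapTime g a := fun a => rfl
  choose ξ hξ hflip hkeep using fun a : Loop × ℕ => hσ.ring a.1 a.2 (τ a) rfl
  let b' : Loop × ℕ → Prop := fun a => Flips ϖ.1 a.1 (ξ a) (ϖ.2.2.2 a.1 a.2)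
  -- Ring times are positive, so statements that hold just before a ring are not vacuous.
  have hne : ∀ a, (𝓝[<] (τ a)).NeBot := fun a =>
    nhdsLT_neBot_of_exists_lt ⟨0, NNReal.coe_lt_coe.1 (hg.pos a)⟩
  have hring : ∀ a v, a.1.Contains v → σ (τ a) v = ξ a v * flipSign (b' a) := by
    intro a v hv
    by_cases h : b' a
    · rw [hflip a h v hv, flipSign, if_pos h, mul_neg_one]
    · rw [hkeep a h v hv, flipSign, if_neg h, mul_one]
  have key : ∀ (n : ℕ) (v : ℤ × ℤ) (t : ℝ≥0), (ringsUpTo g t v).ncard = n →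
      σ t v = configOf ϖ.2.1 b' (ringsUpTo g t) v := by
    intro n
    -- Induction on the number of rings seen at `v`: the spin is constant since the last of them,
    -- and just before it fewer rings had occurred.
    induction n using Nat.strong_induction_on with
    | _ n ih =>
      intro v t hn
      rcases (ringsUpTo g t v).eq_empty_or_nonempty with hA | hA
      · rw [hσ.constant v 0 t zero_le fun γ k hγ hk => ?_, hσ.initial]
        · simp only [configOf, hA, finprod_mem_empty, mul_one]
        · exact Set.notMem_empty (γ, k) (hA ▸ ⟨hγ, hk.2⟩)
      · obtain ⟨a, ha, hmax⟩ := Set.exists_max_image _ (gapTime g) (hg.finite_ringsUpTo t v) hA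
        have hA' : ringsUpTo g t v = ringsUpTo g (gapTime g a) v :=
          Set.Subset.antisymm (fun c hc => ⟨hc.1, hmax c hc⟩) fun c hc => ⟨hc.1, hc.2.trans ha.2⟩
        have hconst : σ t v = σ (τ a) v := by
          refine hσ.constant v (τ a) t (NNReal.coe_le_coe.1 ha.2) fun γ k hγ hk => ?_
          exact absurd (hmax (γ, k) ⟨hγ, hk.2⟩) (not_le.2 hk.1)
        have := hne a
        obtain ⟨s, hs, hs'⟩ := ((hξ a v).and (hg.eventually_ringsUpTo_eq (τ a) v)).exists
        have hcard : (ringsUpTo g s v).ncard < n := by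
          rw [← hn, hs', hA', hg.ringsUpTo_gapTime ha.1, hτ]
          exact Set.ncard_lt_ncard (Set.ssubset_insert fun h => lt_irrefl _ h.2)
            ((hg.finite_ringsBefore _ v).insert a)
        have hA'' : configOf ϖ.2.1 b' (ringsUpTo g t) v =
            configOf ϖ.2.1 b' (ringsUpTo g (gapTime g a)) v := by
          simp only [configOf, hA']
        rw [hconst, hring a v ha.1, ← hs, ih _ hcard v s rfl, hA'', hg.configOf_ringsUpTo ha.1]
        simp only [configOf, hs', hτ]
  have hξ' : ∀ a, ξ a = configOf ϖ.2.1 b' (ringsBefore g (gapTime g a)) := by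
    intro a
    funext v
    have := hne a
    obtain ⟨s, hs, hs'⟩ := ((hξ a v).and (hg.eventually_ringsUpTo_eq (τ a) v)).exists
    rw [← hs, key _ v s rfl]
    simp only [configOf, hs', hτ]
  have hb' : ∀ a, b' a ↔ FlipsAt ϖ b' a := fun a => by
    simp only [b', FlipsAt, hξ' a]
    rfl
  have hbb' : b' = b := by
    funext a
    induction a using hg.wf.induction with
    | _ a ih => exact propext ((hb' a).trans ((flipsAt_congr fun c hc => by rw [ih c hc]).trans
        (hb a).symm))
  funext t v
  rw [key _ v t rfl, hbb']

/-! ### Approximation of the flips by measurable events -/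

theorem exists_exhaustion (α : Type*) [Countable α] :
    ∃ s : ℕ → Finset α, ∀ a, ∀ᶠ n in Filter.atTop, a ∈ s n := by
  obtain ⟨e, he⟩ := exists_injective_nat α
  refine ⟨fun n => (Finset.range n).preimage e he.injOn, fun a => ?_⟩
  filter_upwards [Filter.eventually_gt_atTop (e a)] with n hn
  simpa using hn

/-- The configuration obtained from `σ₀` if at `v` only the rings in `A v` and in `s` are taken into
account and `b` are the rings with a flip. -/
def finiteConfigOf (s : Finset (Loop × ℕ)) (σ₀ : Config) (b : Loop × ℕ → Prop)
    (A : ℤ × ℤ → Set (Loop × ℕ)) : Config :=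
  fun v => σ₀ v * ∏ a ∈ s, flipSign (a ∈ A v ∧ b a)

theorem finiteConfigOf_eq {s : Finset (Loop × ℕ)} {σ₀ : Config} {b b' : Loop × ℕ → Prop}
    {A : ℤ × ℤ → Set (Loop × ℕ)} {v : ℤ × ℤ} (hs : A v ⊆ s) (hb : ∀ a ∈ A v, (b a ↔ b' a)) :
    finiteConfigOf s σ₀ b A v = configOf σ₀ b' A v := by
  classical
  rw [finiteConfigOf, configOf]
  congr 1
  rw [finprod_mem_def, finprod_eq_prod_of_mulSupport_subset (s := s)]
  · refine Finset.prod_congr rfl fun a _ => ?_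
    by_cases ha : a ∈ A v
    · simp only [ha, true_and, Set.mulIndicator_of_mem, hb a ha]
    · simp [ha, flipSign]
  · exact fun a ha => hs (Set.mem_of_mulIndicator_ne_one ha)

/-- The approximate flips after `n` steps. -/
def approxFlip (s : ℕ → Finset (Loop × ℕ)) (ϖ : Sample) : ℕ → Loop × ℕ → Prop
  | 0 => fun _ => False
  | n + 1 => fun a => Flips ϖ.1 a.1 (finiteConfigOf (s n) ϖ.2.1 (approxFlip s ϖ n)
      (ringsBefore ϖ.2.2.1 (gapTime ϖ.2.2.1 a))) (ϖ.2.2.2 a.1 a.2)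

/-- The flips of the dynamics. -/
def limitFlip (s : ℕ → Finset (Loop × ℕ)) (ϖ : Sample) (a : Loop × ℕ) : Prop :=
  ∃ N, ∀ n ≥ N, approxFlip s ϖ n a

section Limit

variable {s : ℕ → Finset (Loop × ℕ)} (hs : ∀ a, ∀ᶠ n in Filter.atTop, a ∈ s n) {ϖ : Sample}
  (hg : IsRegular ϖ.2.2.1)
include hs

theorem eventually_subset_exhaustion {A : Set (Loop × ℕ)} (hA : A.Finite) :
    ∀ᶠ n in Filter.atTop, A ⊆ s n :=
  (Filter.eventually_all_finite hA).2 fun a _ => hs a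

include hg

/-- By induction along `Influences`: finitely many rings enter the decision at `a`, their
approximate flips are eventually constant and lie in `s n`, so the decision at `a` is settled one
step later. -/
theorem eventually_approxFlip_iff (a : Loop × ℕ) :
    (∀ᶠ n in Filter.atTop, (approxFlip s ϖ n a ↔ limitFlip s ϖ a)) ∧
      (limitFlip s ϖ a ↔ FlipsAt ϖ (limitFlip s ϖ) a) := by
  induction a using hg.wf.induction with
  | _ a ih =>
    have hfin : {u | ∃ d ∈ a.1.edges, u ∈ primalEdge d}.Finite := by
      have h1 : ∀ z : Sym2 (ℤ × ℤ), {u | u ∈ z}.Finite := by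
        intro z
        induction z with
        | h x y => exact (Set.toFinite {x, y}).subset fun u hu => by simpa using hu
      refine (a.1.edges.finite_toSet.biUnion fun d _ => h1 (primalEdge d)).subset ?_
      rintro u ⟨d, hd, hu⟩
      exact Set.mem_biUnion (Finset.mem_coe.2 hd) hu
    have hev : ∀ᶠ n in Filter.atTop, ∀ u ∈ {u | ∃ d ∈ a.1.edges, u ∈ primalEdge d},
        finiteConfigOf (s n) ϖ.2.1 (approxFlip s ϖ n) (ringsBefore ϖ.2.2.1 (gapTime ϖ.2.2.1 a)) u =
        configOf ϖ.2.1 (limitFlip s ϖ) (ringsBefore ϖ.2.2.1 (gapTime ϖ.2.2.1 a)) u := by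
      rw [Filter.eventually_all_finite hfin]
      rintro u ⟨d, hd, hu⟩
      have hB := hg.finite_ringsBefore (gapTime ϖ.2.2.1 a) u
      have h2 := (Filter.eventually_all_finite hB).2 fun c hc =>
        (ih c (influences_of_mem_ringsBefore hd hu hc)).1
      filter_upwards [eventually_subset_exhaustion hs hB, h2] with n hn hn'
      exact finiteConfigOf_eq hn hn'
    have hlim : ∀ᶠ n in Filter.atTop,
        (approxFlip s ϖ n a ↔ FlipsAt ϖ (limitFlip s ϖ) a) := by
      -- Step `n + 1` of the approximation is computed from step `n` and `s n`.
      rw [← Filter.map_add_atTop_eq_nat 1, Filter.eventually_map]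
      filter_upwards [hev] with n hn
      exact flips_congr fun d hd u hu => hn u ⟨d, hd, hu⟩
    have hfix : limitFlip s ϖ a ↔ FlipsAt ϖ (limitFlip s ϖ) a := by
      constructor
      · intro h
        obtain ⟨n, h1, h2⟩ := ((Filter.eventually_atTop.2 h).and hlim).exists
        exact h2.1 h1
      · intro h
        exact Filter.eventually_atTop.1 (hlim.mono fun n hn => hn.2 h)
    exact ⟨hlim.mono fun n hn => hn.trans hfix.symm, hfix⟩

end Limit

open Classical in
/-- The configuration at time `t`, as a limit of measurable approximations. -/
def dynamics (s : ℕ → Finset (Loop × ℕ)) (t : ℝ≥0) (ϖ : Sample) : Config := fun v =>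
  if ∃ N, ∀ n ≥ N, finiteConfigOf (s n) ϖ.2.1 (limitFlip s ϖ) (ringsUpTo ϖ.2.2.1 t) v = 1
  then 1 else -1

theorem dynamics_eq {s : ℕ → Finset (Loop × ℕ)} (hs : ∀ a, ∀ᶠ n in Filter.atTop, a ∈ s n)
    {ϖ : Sample} (hg : IsRegular ϖ.2.2.1) (t : ℝ≥0) :
    dynamics s t ϖ = configOf ϖ.2.1 (limitFlip s ϖ) (ringsUpTo ϖ.2.2.1 t) := by
  funext v
  have h : ∀ᶠ n in Filter.atTop,
      finiteConfigOf (s n) ϖ.2.1 (limitFlip s ϖ) (ringsUpTo ϖ.2.2.1 t) v =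
        configOf ϖ.2.1 (limitFlip s ϖ) (ringsUpTo ϖ.2.2.1 t) v := by
    filter_upwards [eventually_subset_exhaustion hs (hg.finite_ringsUpTo t v)] with n hn
    exact finiteConfigOf_eq hn fun _ _ => Iff.rfl
  rw [dynamics]
  split_ifs with h1
  · obtain ⟨n, h2, h3⟩ := ((Filter.eventually_atTop.2 h1).and h).exists
    rw [← h3, h2]
  -- The approximations are eventually equal to the true spin, so a spin `1` would contradict the
  -- failed test.
  · rcases Int.units_eq_one_or (configOf ϖ.2.1 (limitFlip s ϖ) (ringsUpTo ϖ.2.2.1 t) v) with h2 | h2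
    · rw [h2] at h
      exact absurd (Filter.eventually_atTop.1 h) h1
    · exact h2.symm

/-! ### Measurability -/

instance : DiscreteMeasurableSpace ℤˣ where
  forall_measurableSet A := ⟨Units.val '' A, trivial, Set.preimage_image_eq A Units.val_injective⟩

theorem measurable_flipSign {α : Type*} [MeasurableSpace α] {p : α → Prop}
    (hp : MeasurableSet {x | p x}) : Measurable fun x => flipSign (p x) :=
  Measurable.ite hp measurable_const measurable_const

theorem measurable_finiteConfigOf (s : Finset (Loop × ℕ)) {b : Sample → Loop × ℕ → Prop}
    {A : Sample → ℤ × ℤ → Set (Loop × ℕ)} (hb : ∀ a, MeasurableSet {ϖ | b ϖ a})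
    (hA : ∀ v a, MeasurableSet {ϖ | a ∈ A ϖ v}) :
    Measurable fun ϖ : Sample => finiteConfigOf s ϖ.2.1 (b ϖ) (A ϖ) := by
  refine measurable_pi_lambda _ fun v => ?_
  have h1 : Measurable fun ϖ : Sample => ϖ.2.1 v := by fun_prop
  have h2 : Measurable fun ϖ : Sample => ∏ a ∈ s, flipSign (a ∈ A ϖ v ∧ b ϖ a) :=
    Finset.measurable_prod _ fun a _ => measurable_flipSign ((hA v a).inter (hb a))
  exact h1.mul h2

theorem measurable_ringTime (a : Loop × ℕ) :
    Measurable fun ϖ : Sample => gapTime ϖ.2.2.1 a :=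
  (measurable_gapTime a).comp (by fun_prop)

theorem measurableSet_mem_ringsBefore {T : Sample → ℝ} (hT : Measurable T) (v : ℤ × ℤ)
    (a : Loop × ℕ) : MeasurableSet {ϖ : Sample | a ∈ ringsBefore ϖ.2.2.1 (T ϖ) v} :=
  (MeasurableSet.const _).inter (measurableSet_lt (measurable_ringTime a) hT)

theorem measurableSet_mem_ringsUpTo (t : ℝ) (v : ℤ × ℤ) (a : Loop × ℕ) :
    MeasurableSet {ϖ : Sample | a ∈ ringsUpTo ϖ.2.2.1 t v} :=
  (MeasurableSet.const _).inter (measurableSet_le (measurable_ringTime a) measurable_const)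

theorem measurableSet_flips (a : Loop × ℕ) {ξ : Sample → Config} (hξ : Measurable ξ) :
    MeasurableSet {ϖ : Sample | Flips ϖ.1 a.1 (ξ ϖ) (ϖ.2.2.2 a.1 a.2)} := by
  have hspin : ∀ z, Measurable fun ϖ => spinProduct (ξ ϖ) z := by
    intro z
    induction z with
    | h x y =>
      have h1 : Measurable fun ϖ => (ξ ϖ x, ξ ϖ y) :=
        ((measurable_pi_apply x).comp hξ).prodMk ((measurable_pi_apply y).comp hξ)
      have h2 : Measurable fun p : ℤˣ × ℤˣ => (((p.1 * p.2 : ℤˣ) : ℤ) : ℝ) :=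
        Measurable.of_discrete
      exact h2.comp h1
  have henergy : Measurable fun ϖ : Sample => loopEnergy ϖ.1 a.1 (ξ ϖ) := by
    unfold loopEnergy
    refine (Finset.measurable_sum _ fun d _ => ?_).neg
    refine Measurable.mul ?_ (hspin _)
    fun_prop
  have hcoin : Measurable fun ϖ : Sample => ϖ.2.2.2 a.1 a.2 := by fun_prop
  exact (measurableSet_lt measurable_const henergy).union
    ((henergy (measurableSet_singleton 0)).inter (hcoin (measurableSet_singleton true)))

theorem measurableSet_approxFlip (s : ℕ → Finset (Loop × ℕ)) (n : ℕ) (a : Loop × ℕ) :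
    MeasurableSet {ϖ : Sample | approxFlip s ϖ n a} := by
  induction n generalizing a with
  | zero => exact MeasurableSet.empty
  | succ n ih =>
    exact measurableSet_flips a (measurable_finiteConfigOf (s n) ih
      fun v c => measurableSet_mem_ringsBefore (measurable_ringTime a) v c)

theorem measurableSet_exists_forall_ge {α : Type*} [MeasurableSpace α] {p : ℕ → α → Prop}
    (hp : ∀ n, MeasurableSet {x | p n x}) : MeasurableSet {x | ∃ N, ∀ n ≥ N, p n x} := by
  have : {x | ∃ N, ∀ n ≥ N, p n x} = ⋃ N, ⋂ n, ⋂ (_ : n ≥ N), {x | p n x} := by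
    ext x; simp
  rw [this]
  exact MeasurableSet.iUnion fun N => MeasurableSet.iInter fun n => MeasurableSet.iInter fun _ => hp n

/-- Finite products and countable limits are defined for every sample, so no regularity of the ring
times is required here. -/
theorem measurable_dynamics (s : ℕ → Finset (Loop × ℕ)) (t : ℝ≥0) : Measurable (dynamics s t) := by
  refine measurable_pi_lambda _ fun v => ?_
  refine Measurable.ite (measurableSet_exists_forall_ge fun n => ?_) measurable_const
    measurable_const
  have h := measurable_finiteConfigOf (s n) (A := fun ϖ => ringsUpTo ϖ.2.2.1 t)
    (fun a => measurableSet_exists_forall_ge fun m => measurableSet_approxFlip s m a)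
    fun v a => measurableSet_mem_ringsUpTo t v a
  exact ((measurable_pi_apply v).comp h) (measurableSet_singleton 1)

/-! ### Transfer to the joint law and conclusion -/

theorem ae_isRegular_jointLaw (νJ : Measure ℝ) [IsProbabilityMeasure νJ]
    (νS : Measure ℤˣ) [IsProbabilityMeasure νS] {f : Loop → ℝ} (hf : ∀ γ, 0 < f γ)
    (hproper : Proper f) (hsum : totalWeight f < ∞) :
    ∀ᵐ ϖ ∂(jointLaw νJ νS f), IsRegular ϖ.2.2.1 := by
  have := fun γ => isProbabilityMeasure_expMeasure (hf γ)
  have h1 : Measure.QuasiMeasurePreserving (fun ω : Clocks => ω.1) (clockLaw f) (gapLaw f) :=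
    Measure.quasiMeasurePreserving_fst
  have : IsProbabilityMeasure (clockLaw f) := by unfold clockLaw; infer_instance
  have h2 : Measure.QuasiMeasurePreserving (fun ϖ : Sample => ϖ.2.2.1) (jointLaw νJ νS f)
      (gapLaw f) :=
    h1.comp (Measure.quasiMeasurePreserving_snd.comp Measure.quasiMeasurePreserving_snd)
  exact h2.ae (ae_isRegular hf hproper hsum)

end LoopDynamics
end

theorem mainTheorem11 (νJ : Measure ℝ) [IsProbabilityMeasure νJ]
    (νS : Measure ℤˣ) [IsProbabilityMeasure νS]
    (f : LoopDynamics.Loop → ℝ) (hf : ∀ γ, 0 < f γ) (hproper : LoopDynamics.Proper f)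
    (hsum : LoopDynamics.totalWeight f < ∞) :
    ∃ X : ℝ≥0 → LoopDynamics.Sample → LoopDynamics.Config,
      (∀ t, Measurable (X t)) ∧
      ∀ᵐ ϖ ∂(LoopDynamics.jointLaw νJ νS f),
        LoopDynamics.IsEvolution ϖ (fun t => X t ϖ) ∧
        ∀ σ : ℝ≥0 → LoopDynamics.Config, LoopDynamics.IsEvolution ϖ σ → σ = fun t => X t ϖ := by
  obtain ⟨s, hs⟩ := LoopDynamics.exists_exhaustion (LoopDynamics.Loop × ℕ)
  refine ⟨LoopDynamics.dynamics s, LoopDynamics.measurable_dynamics s, ?_⟩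
  filter_upwards [LoopDynamics.ae_isRegular_jointLaw νJ νS hf hproper hsum] with ϖ hϖ
  have hb := fun a => (LoopDynamics.eventually_approxFlip_iff hs hϖ a).2
  simp only [LoopDynamics.dynamics_eq hs hϖ]
  exact ⟨LoopDynamics.isEvolution_configOf hϖ hb, fun σ hσ => hσ.eq_configOf hϖ hb⟩
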